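/- For a group $G$, let $G\otimes G$ denote the non-abelian tensor square of $G$: the group generated by the symbols $g\otimes h$ ($g,h\in G$) subject to the relations $$g_1g\otimes h=({}^{g_1}g\otimes{}^{g_1}h)(g_1\otimes h),\qquad g\otimes h_1h=(g\otimes h_1)({}^{h_1}g\otimes{}^{h_1}h)\qquad(g,g_1,h,h_1\in G),$$ where ${}^{x}y=xyx^{-1}$. Write $G'$ for the commutator subgroup of $G$ and $G^{ab}=G/G'$. Let $p<q<r$ be primes and let $G$ be a nonabelian group of order $p^2qr$. If $pq\neq 6$, then $|G'|\in\{q,r,qr\}$. Moreover, whether or not $pq=6$: (i) If $|G'|=q$, or $|G'|=r$, or $|G'|=qr$ with $q\nmid r-1$, then $G\otimes G\cong\mathbb{Z}_{p^2qr}$ when $G^{ab}$ is cyclic, and $G\otimes G\cong(\mathbb{Z}_p)^4\times\mathbb{Z}_{qr}$ otherwise. (ii) If $|G'|=qr$ with $q\mid r-1$, then $G\otimes G\cong\mathbb{Z}_{p^2}\times G'$ when $G^{ab}$ is cyclic, and $G\otimes G\cong(\mathbb{Z}_p)^4\times G'$ otherwise. Finally, suppose that $pq=6$, so that $|G|=12r$.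 If $G$ is not perfect (that is, $G'\neq G$), then $|G'|\in\{3,r,3r,4,4r\}$. If $|G'|=4$ or $|G'|=4r$, then $G\otimes G\cong\mathbb{Z}_{3r}\times Q_8$, where $Q_8$ is the quaternion group of order $8$. -/

import Mathlib

/-- The defining relations of the non-abelian tensor square of `G`, on symbols `(g, h)` standing for
`g ⊗ h`, where `G` acts on itself by conjugation `ᵍh = g * h * g⁻¹`:
`g₁g ⊗ h = (ᵍ¹g ⊗ ᵍ¹h)(g₁ ⊗ h)` and `g ⊗ h₁h = (g ⊗ h₁)(ʰ¹g ⊗ ʰ¹h)`. -/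
inductive TensorSquareRel (G : Type*) [Group G] : FreeGroup (G × G) → Prop
  | left (g₁ g h : G) : TensorSquareRel G
      (FreeGroup.of (g₁ * g, h) *
        (FreeGroup.of (g₁ * g * g₁⁻¹, g₁ * h * g₁⁻¹) * FreeGroup.of (g₁, h))⁻¹)
  | right (g h₁ h : G) : TensorSquareRel G
      (FreeGroup.of (g, h₁ * h) *
        (FreeGroup.of (g, h₁) * FreeGroup.of (h₁ * g * h₁⁻¹, h₁ * h * h₁⁻¹))⁻¹)

/-- The non-abelian tensor square `G ⊗ G` (Brown–Loday): the group generated by symbols `g ⊗ h`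
subject to the relations `TensorSquareRel`. -/
abbrev TensorSquare (G : Type*) [Group G] : Type _ :=
  PresentedGroup {w : FreeGroup (G × G) | TensorSquareRel G w}

/-! The commutator map `kappa : G ⊗ G → G'` makes `G ⊗ G` a crossed module over `G`: `act (kappa t)`
is conjugation by `t` (`act_kappa`), so the kernel of `kappa` is central, and `G` acts trivially on
it because `kappa t ⊗ h = t * (act h t)⁻¹` (`kappa_tmul_eq`). For normal `N`, the kernel of `G ⊗ G →
G/N ⊗ G/N` is generated by the symbols with an entry in `N` (`ker_map_mk'`).

Parts (i) and (ii) have one source. There `|G'|` divides `qr` and is prime to the index of `G'`; a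
commutator subgroup of squarefree order is cyclic (`isCyclic_commutator_of_isZGroup`). Then `G ⊗ G`
is abelian, and the joint kernel of the maps to `Gᵃᵇ ⊗ Gᵃᵇ` and to `G'` is killed by `|G'|` and,
through a norm over `Gᵃᵇ`, by the index. So `G ⊗ G ≅ (Gᵃᵇ ⊗ Gᵃᵇ) × G'`
(`nonempty_equiv_prod_of_coprime`), and the tensor square of the abelian group `Gᵃᵇ` is computed
directly.

The possible orders of `G'` come from Burnside transfer. If a Sylow `p`-subgroup is central in its
normalizer, then `|G'|` divides `qr`; this can fail only when a prime `ℓ > p` dividing `qr` divides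
`p + 1`, which forces `p = 2`, `q = 3`. For order `12r`, failure puts the Sylow 2-subgroup inside
`G'`, and `|G'| = 12` is excluded separately.

If `|G'|` is `4` or `4r`, a normal four-group `V ≤ G'` exists, and `G / V` has squarefree order
`3r`. The kernel of `G ⊗ G → G/V ⊗ G/V` has at most eight elements (`mem_relKer_of_kleinRotation`).
The action of `G` on four points lands in `A₄`; commutators of lifts to the binary tetrahedral group
give a map `G ⊗ G → Q₈` that is injective on this kernel and, by counting, splits it off
(`nonempty_equiv_prod_quaternionGroup`). -/

namespace TensorSquare

/-! ### The non-abelian tensor square as a crossed module -/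

open scoped commutatorElement

variable {G : Type*} [Group G]

/-- The generator `g ⊗ h`. -/
def tmul (g h : G) : TensorSquare G := PresentedGroup.of (g, h)

theorem mul_tmul' (g₁ g h : G) :
    tmul (g₁ * g) h = tmul (g₁ * g * g₁⁻¹) (g₁ * h * g₁⁻¹) * tmul g₁ h :=
  PresentedGroup.mk_eq_mk_of_mul_inv_mem (TensorSquareRel.left g₁ g h)

theorem tmul_mul' (g h₁ h : G) :
    tmul g (h₁ * h) = tmul g h₁ * tmul (h₁ * g * h₁⁻¹) (h₁ * h * h₁⁻¹) :=
  PresentedGroup.mk_eq_mk_of_mul_inv_mem (TensorSquareRel.right g h₁ h)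

theorem induction {C : TensorSquare G → Prop} (one : C 1) (tmul : ∀ g h, C (tmul g h))
    (mul : ∀ s t, C s → C t → C (s * t)) (inv : ∀ t, C t → C t⁻¹) (t : TensorSquare G) : C t := by
  have h : t ∈ Subgroup.closure
      (Set.range (PresentedGroup.of : G × G → TensorSquare G)) := by
    rw [PresentedGroup.closure_range_of]; trivial
  induction h using Subgroup.closure_induction with
  | mem x hx => obtain ⟨⟨g, h⟩, rfl⟩ := hx; exact tmul g h
  | one => exact one
  | mul x y _ _ hx hy => exact mul x y hx hy
  | inv x _ hx => exact inv x hx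

/-- The homomorphism induced by a crossed pairing. -/
def lift {H : Type*} [Group H] (f : G → G → H)
    (hl : ∀ g₁ g h, f (g₁ * g) h = f (g₁ * g * g₁⁻¹) (g₁ * h * g₁⁻¹) * f g₁ h)
    (hr : ∀ g h₁ h, f g (h₁ * h) = f g h₁ * f (h₁ * g * h₁⁻¹) (h₁ * h * h₁⁻¹)) :
    TensorSquare G →* H :=
  PresentedGroup.toGroup (f := fun x : G × G => f x.1 x.2) (by
    rintro _ (⟨g₁, g, h⟩ | ⟨g, h₁, h⟩)
    · simp only [map_mul, map_inv, FreeGroup.lift_apply_of]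
      rw [hl, mul_inv_cancel]
    · simp only [map_mul, map_inv, FreeGroup.lift_apply_of]
      rw [hr, mul_inv_cancel])

@[simp]
theorem lift_tmul {H : Type*} [Group H] (f : G → G → H) (hl) (hr) (g h : G) :
    lift f hl hr (tmul g h) = f g h :=
  PresentedGroup.toGroup.of _

theorem hom_ext {H : Type*} [Group H] {φ ψ : TensorSquare G →* H}
    (h : ∀ a b, φ (tmul a b) = ψ (tmul a b)) : φ = ψ :=
  PresentedGroup.ext fun x => h x.1 x.2

/-- Functoriality of the tensor square. -/
def map {H : Type*} [Group H] (f : G →* H) : TensorSquare G →* TensorSquare H :=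
  lift (fun g h => tmul (f g) (f h))
    (fun g₁ g h => by simp only [map_mul, map_inv]; exact mul_tmul' _ _ _)
    (fun g h₁ h => by simp only [map_mul, map_inv]; exact tmul_mul' _ _ _)

@[simp]
theorem map_tmul {H : Type*} [Group H] (f : G →* H) (g h : G) :
    map f (tmul g h) = tmul (f g) (f h) := lift_tmul _ _ _ _ _

/-- Isomorphic groups have isomorphic tensor squares. -/
def congr {H : Type*} [Group H] (e : G ≃* H) : TensorSquare G ≃* TensorSquare H :=
  MonoidHom.toMulEquiv (map e.toMonoidHom) (map e.symm.toMonoidHom)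
    (hom_ext fun _ _ => by simp) (hom_ext fun _ _ => by simp)

/-- The action of `G` on its tensor square by conjugation. -/
def act (x : G) : TensorSquare G →* TensorSquare G := map (MulAut.conj x).toMonoidHom

@[simp]
theorem act_tmul (x g h : G) : act x (tmul g h) = tmul (x * g * x⁻¹) (x * h * x⁻¹) := by
  simp [act]

theorem act_mul (x y : G) (t : TensorSquare G) : act (x * y) t = act x (act y t) := by
  have : act (x * y) = (act x).comp (act y) := hom_ext fun a b => by simp [mul_assoc]
  rw [this]; rfl

@[simp]
theorem act_one (t : TensorSquare G) : act 1 t = t := by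
  have : act (1 : G) = MonoidHom.id _ := hom_ext fun a b => by simp
  rw [this]; rfl

theorem act_act_inv (x : G) (t : TensorSquare G) : act x (act x⁻¹ t) = t := by
  rw [← act_mul]; simp

theorem mul_tmul (g₁ g h : G) : tmul (g₁ * g) h = act g₁ (tmul g h) * tmul g₁ h := by
  rw [mul_tmul', act_tmul]

theorem tmul_mul (g h₁ h : G) : tmul g (h₁ * h) = tmul g h₁ * act h₁ (tmul g h) := by
  rw [tmul_mul', act_tmul]

@[simp]
theorem one_tmul (h : G) : tmul 1 h = 1 := by
  simpa using mul_tmul 1 1 h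

@[simp]
theorem tmul_one (g : G) : tmul g 1 = 1 := by
  simpa using tmul_mul g 1 1

theorem act_inv_tmul (g h : G) : act g (tmul g⁻¹ h) = (tmul g h)⁻¹ := by
  have := mul_tmul g g⁻¹ h
  rw [mul_inv_cancel, one_tmul] at this
  exact eq_inv_of_mul_eq_one_left this.symm

theorem act_tmul_inv (g h : G) : act h (tmul g h⁻¹) = (tmul g h)⁻¹ := by
  have := tmul_mul g h h⁻¹
  rw [mul_inv_cancel, tmul_one] at this
  exact (inv_eq_of_mul_eq_one_right this.symm).symm

/-- The commutator map `g ⊗ h ↦ [g, h]`. -/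
def kappa : TensorSquare G →* G :=
  lift (fun g h => ⁅g, h⁆) (fun g₁ g h => by simp only [commutatorElement_def]; group)
    (fun g h₁ h => by simp only [commutatorElement_def]; group)

@[simp]
theorem kappa_tmul (g h : G) : kappa (tmul g h) = ⁅g, h⁆ := lift_tmul _ _ _ _ _

theorem range_kappa : (kappa : TensorSquare G →* G).range = commutator G := by
  apply le_antisymm
  · rintro _ ⟨t, rfl⟩
    induction t using TensorSquare.induction with
    | one => rw [map_one]; exact one_mem _
    | tmul g h =>
      rw [kappa_tmul]
      exact Subgroup.commutator_mem_commutator (Subgroup.mem_top g) (Subgroup.mem_top h)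
    | mul s t hs ht => rw [map_mul]; exact mul_mem hs ht
    | inv t ht => rw [map_inv]; exact inv_mem ht
  · rw [commutator_def, Subgroup.commutator_le]
    exact fun g _ h _ => ⟨tmul g h, kappa_tmul g h⟩

theorem kappa_mem (t : TensorSquare G) : kappa t ∈ commutator G := by
  rw [← range_kappa]; exact ⟨t, rfl⟩

theorem exists_kappa_eq {c : G} (hc : c ∈ commutator G) : ∃ t, kappa t = c := by
  rw [← range_kappa] at hc; exact hc

/-- For a symbol `s = g' ⊗ h'`, expand `(g * g') ⊗ (h * h')` in the left variable first and then in
the right one first, and cancel the common outer factors. -/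
theorem act_mul_tmul (g h : G) (s : TensorSquare G) :
    act (g * h) s * tmul g h = tmul g h * act (h * g) s := by
  have key : ∀ g' h', act (g * h) (tmul g' h') * tmul g h
      = tmul g h * act (h * g) (tmul g' h') := by
    intro g' h'
    have e1 : tmul (g * g') (h * h') = act g (tmul g' h) * (act (g * h) (tmul g' h') *
        tmul g h) * act h (tmul g h') := by
      rw [mul_tmul, tmul_mul g' h h', tmul_mul g h h', map_mul, act_mul]
      simp only [mul_assoc]
    have e2 : tmul (g * g') (h * h') = act g (tmul g' h) * (tmul g h *
        act (h * g) (tmul g' h')) * act h (tmul g h') := by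
      rw [tmul_mul, mul_tmul g g' h, mul_tmul g g' h', map_mul, act_mul]
      simp only [mul_assoc]
    exact mul_left_cancel (mul_right_cancel (e1.symm.trans e2))
  induction s using TensorSquare.induction with
  | one => simp
  | tmul a b => exact key a b
  | mul s t hs ht => rw [map_mul, map_mul, mul_assoc, ht, ← mul_assoc, hs, mul_assoc]
  | inv t ht =>
    rw [map_inv, map_inv, inv_mul_eq_iff_eq_mul, ← mul_assoc, ht, mul_assoc, mul_inv_cancel,
      mul_one]

/-- The Peiffer identity. On a symbol it is `act_mul_tmul` with `s` replaced by its translate under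
`(h * g)⁻¹`. -/
theorem act_kappa (t s : TensorSquare G) : act (kappa t) s = t * s * t⁻¹ := by
  induction t using TensorSquare.induction generalizing s with
  | one => simp
  | tmul g h =>
    rw [kappa_tmul, eq_mul_inv_iff_mul_eq]
    have := act_mul_tmul g h (act (h * g)⁻¹ s)
    rwa [act_act_inv, ← act_mul, mul_inv_rev, ← mul_assoc, ← commutatorElement_def] at this
  | mul t u ht hu => rw [map_mul, act_mul, hu, ht]; simp only [mul_assoc, mul_inv_rev]
  | inv t ht =>
    have := ht (act (kappa t)⁻¹ s)
    rw [act_act_inv] at this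
    rw [map_inv]
    conv_rhs => rw [this]
    group

theorem commutator_tmul (m n k : G) : tmul ⁅m, n⁆ k = tmul m n * (act k (tmul m n))⁻¹ := by
  -- This is the `n`-translate of `m⁻¹ ⊗ (n⁻¹ * k * n)`, whose right entry expands as a product of
  -- three factors.
  have e1 : tmul (n * m⁻¹ * n⁻¹) k = (tmul m⁻¹ n)⁻¹ * tmul m⁻¹ k * act k (tmul m⁻¹ n) := by
    have h1 : tmul m⁻¹ (n⁻¹ * k * n) = tmul m⁻¹ n⁻¹ *
        act n⁻¹ (tmul m⁻¹ k * act k (tmul m⁻¹ n)) := by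
      rw [mul_assoc, tmul_mul, tmul_mul]
    have h2 := congrArg (act n) h1
    rw [map_mul, act_act_inv, act_tmul_inv, act_tmul] at h2
    rw [mul_assoc (tmul m⁻¹ n)⁻¹, ← h2]
    congr 1
    group
  have e2 : act m (act k (tmul m⁻¹ n)) = act (m * k * m⁻¹) (tmul m n)⁻¹ := by
    rw [← act_inv_tmul, ← act_mul, ← act_mul]
    congr 2
    group
  have e3 : (tmul m k)⁻¹ * act (m * k * m⁻¹) (tmul m n)⁻¹ * tmul m k =
      act k (tmul m n)⁻¹ := by
    have h3 := act_kappa (tmul m k)⁻¹ (act (m * k * m⁻¹) (tmul m n)⁻¹)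
    rw [inv_inv] at h3
    rw [← h3, ← act_mul, map_inv (kappa (G := G)), kappa_tmul]
    congr 2
    rw [commutatorElement_def]
    group
  have e4 : ⁅m, n⁆ = m * (n * m⁻¹ * n⁻¹) := by rw [commutatorElement_def]; group
  rw [e4, mul_tmul, e1, map_mul, map_mul, map_inv, act_inv_tmul, act_inv_tmul, e2, inv_inv,
    ← map_inv, ← e3]
  simp only [mul_assoc]

theorem kappa_tmul_eq (t : TensorSquare G) (h : G) : tmul (kappa t) h = t * (act h t)⁻¹ := by
  induction t using TensorSquare.induction with
  | one => simp
  | tmul m n => rw [kappa_tmul, commutator_tmul]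
  | mul s t hs ht =>
    rw [map_mul, mul_tmul, act_kappa, hs, ht, map_mul]
    group
  | inv t ht =>
    have h1 := mul_tmul (kappa t) (kappa t)⁻¹ h
    rw [mul_inv_cancel, one_tmul, act_kappa, ht] at h1
    have h2 : tmul (kappa t)⁻¹ h = t⁻¹ * (t * (act h t)⁻¹)⁻¹ * t := by
      rw [eq_inv_of_mul_eq_one_left h1.symm |>.symm]
      group
    rw [map_inv, h2, map_inv]
    group

/-- Substituting `gk = ⁅g, k⁆kg` on the left and `kh = ⁅k, h⁆hk` on the right gives two expansions
to compare; the first uses the mirror formula `kappa_tmul_eq`. -/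
theorem tmul_commutator (g k h : G) : tmul g ⁅k, h⁆ = act g (tmul k h) * (tmul k h)⁻¹ := by
  have e1 : tmul (g * k) h * act h (tmul g k) = tmul g k * tmul (k * g) h := by
    have e0 : g * k = ⁅g, k⁆ * (k * g) := by rw [commutatorElement_def]; group
    have e2 : tmul (g * k) h = act ⁅g, k⁆ (tmul (k * g) h) * tmul ⁅g, k⁆ h := by
      conv_lhs => rw [e0]
      exact mul_tmul _ _ _
    rw [e2, ← kappa_tmul g k, act_kappa, kappa_tmul_eq]
    group
  have e3 : k * h = ⁅k, h⁆ * (h * k) := by rw [commutatorElement_def]; group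
  have e4 : tmul g (k * h) = tmul g ⁅k, h⁆ * (tmul k h * tmul g (h * k) * (tmul k h)⁻¹) := by
    rw [← act_kappa, kappa_tmul, ← tmul_mul, ← e3]
  rw [mul_tmul, mul_tmul, mul_assoc, ← tmul_mul, ← mul_assoc, ← tmul_mul, e4] at e1
  have e5 : act g (tmul k h) * tmul g (h * k) = tmul g ⁅k, h⁆ * tmul k h * tmul g (h * k) := by
    rw [e1]; group
  rw [eq_mul_inv_iff_mul_eq]
  exact (mul_right_cancel e5).symm

theorem tmul_kappa_eq (t : TensorSquare G) (h : G) : tmul h (kappa t) = act h t * t⁻¹ := by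
  induction t using TensorSquare.induction with
  | one => simp
  | tmul m n => rw [kappa_tmul, tmul_commutator]
  | mul s t hs ht =>
    rw [map_mul, tmul_mul, act_kappa, hs, ht, map_mul]
    group
  | inv t ht =>
    have h1 := tmul_mul h (kappa t) (kappa t)⁻¹
    rw [mul_inv_cancel, tmul_one, act_kappa, ht] at h1
    have h2 : tmul h (kappa t)⁻¹ = t⁻¹ * (act h t * t⁻¹)⁻¹ * t := by
      rw [inv_eq_of_mul_eq_one_right h1.symm]
      group
    rw [map_inv, h2, map_inv]
    group

theorem tmul_kappa_eq_inv (t : TensorSquare G) (h : G) :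
    tmul h (kappa t) = (tmul (kappa t) h)⁻¹ := by
  rw [tmul_kappa_eq, kappa_tmul_eq]; group

theorem kappa_tmul_kappa (t s : TensorSquare G) : tmul (kappa t) (kappa s) = ⁅t, s⁆ := by
  rw [kappa_tmul_eq, act_kappa, commutatorElement_def]; group

theorem comm_of_kappa_eq_one {t : TensorSquare G} (ht : kappa t = 1) (s : TensorSquare G) :
    t * s = s * t := by
  have := act_kappa t s
  rw [ht, act_one, eq_mul_inv_iff_mul_eq] at this
  exact this.symm

/-- In `kappa_tmul_eq` the left side becomes `1 ⊗ h = 1`. -/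
theorem act_of_kappa_eq_one {t : TensorSquare G} (ht : kappa t = 1) (h : G) : act h t = t := by
  have := kappa_tmul_eq t h
  rw [ht, one_tmul] at this
  exact (mul_inv_eq_one.mp this.symm).symm

/-! ### The kernel of the map to the tensor square of a quotient -/

section Quotient

variable (N : Subgroup G)

/-- The subgroup of the tensor square generated by the symbols with an entry in `N`. -/
def relKer : Subgroup (TensorSquare G) :=
  Subgroup.closure {t | ∃ n ∈ N, ∃ g, t = tmul n g ∨ t = tmul g n}

variable {N}

theorem tmul_mem_relKer_left {n : G} (hn : n ∈ N) (g : G) : tmul n g ∈ relKer N :=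
  Subgroup.subset_closure ⟨n, hn, g, Or.inl rfl⟩

theorem tmul_mem_relKer_right {n : G} (hn : n ∈ N) (g : G) : tmul g n ∈ relKer N :=
  Subgroup.subset_closure ⟨n, hn, g, Or.inr rfl⟩

theorem act_mem_relKer [N.Normal] (x : G) {t : TensorSquare G} (ht : t ∈ relKer N) :
    act x t ∈ relKer N := by
  unfold relKer at ht
  induction ht using Subgroup.closure_induction with
  | mem t ht =>
    obtain ⟨n, hn, g, rfl | rfl⟩ := ht
    · rw [act_tmul]
      exact tmul_mem_relKer_left (Subgroup.Normal.conj_mem inferInstance n hn x) _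
    · rw [act_tmul]
      exact tmul_mem_relKer_right (Subgroup.Normal.conj_mem inferInstance n hn x) _
  | one => rw [map_one]; exact one_mem _
  | mul s t _ _ hs ht => rw [map_mul]; exact mul_mem hs ht
  | inv t _ ht => rw [map_inv]; exact inv_mem ht

instance relKer_normal [N.Normal] : (relKer N).Normal :=
  ⟨fun t ht s => by rw [← act_kappa]; exact act_mem_relKer _ ht⟩

theorem mk_tmul_congr [N.Normal] {g g' h h' : G} (hg : (g : G ⧸ N) = g') (hh : (h : G ⧸ N) = h') :
    (tmul g h : TensorSquare G ⧸ relKer N) = tmul g' h' := by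
  obtain ⟨n, rfl⟩ : ∃ n : N, g' = g * n :=
    ⟨⟨g⁻¹ * g', QuotientGroup.eq.mp hg⟩, by simp⟩
  obtain ⟨m, rfl⟩ : ∃ n : N, h' = h * n :=
    ⟨⟨h⁻¹ * h', QuotientGroup.eq.mp hh⟩, by simp⟩
  have e1 : (tmul (g * n) (h * m) : TensorSquare G ⧸ relKer N) = tmul g (h * m) := by
    rw [mul_tmul, QuotientGroup.mk_mul,
      (QuotientGroup.eq_one_iff _).mpr (act_mem_relKer g (tmul_mem_relKer_left n.2 _)), one_mul]
  rw [e1, tmul_mul, QuotientGroup.mk_mul,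
    (QuotientGroup.eq_one_iff (act h _)).mpr (act_mem_relKer h (tmul_mem_relKer_right m.2 _)),
    mul_one]

/-- Modulo `relKer N` a symbol depends only on the cosets of its entries, so coset representatives
define a map from the tensor square of `G ⧸ N` through which the projection factors. -/
theorem ker_map_mk' [N.Normal] : (map (QuotientGroup.mk' N)).ker = relKer N := by
  apply le_antisymm
  · have hout : ∀ x : G ⧸ N, ((x.out : G) : G ⧸ N) = x := QuotientGroup.out_eq'
    let ψ : TensorSquare (G ⧸ N) →* TensorSquare G ⧸ relKer N :=
      lift (fun x y => (tmul x.out y.out : TensorSquare G ⧸ relKer N))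
        (fun g₁ g h => by
          rw [← QuotientGroup.mk_mul]
          rw [mk_tmul_congr (g' := g₁.out * g.out) (h' := h.out) (by simp) rfl, mul_tmul',
            QuotientGroup.mk_mul, QuotientGroup.mk_mul]
          congr 1
          exact mk_tmul_congr (by simp) (by simp))
        (fun g h₁ h => by
          rw [← QuotientGroup.mk_mul]
          rw [mk_tmul_congr (g' := g.out) (h' := h₁.out * h.out) rfl (by simp), tmul_mul',
            QuotientGroup.mk_mul, QuotientGroup.mk_mul]
          congr 1
          exact mk_tmul_congr (by simp) (by simp))
    have hψ : ψ.comp (map (QuotientGroup.mk' N)) = QuotientGroup.mk' (relKer N) :=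
      hom_ext fun g h => by
        simp only [MonoidHom.comp_apply, map_tmul, ψ, lift_tmul]
        exact mk_tmul_congr (by simp) (by simp)
    intro t ht
    rw [← QuotientGroup.ker_mk' (relKer N), ← hψ, MonoidHom.mem_ker, MonoidHom.comp_apply,
      MonoidHom.mem_ker.mp ht, map_one]
  · rw [relKer, Subgroup.closure_le]
    rintro _ ⟨n, hn, g, rfl | rfl⟩
    · rw [SetLike.mem_coe, MonoidHom.mem_ker, map_tmul]
      simp [(QuotientGroup.eq_one_iff n).mpr hn]
    · rw [SetLike.mem_coe, MonoidHom.mem_ker, map_tmul]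
      simp [(QuotientGroup.eq_one_iff n).mpr hn]

theorem map_surjective {H : Type*} [Group H] {f : G →* H} (hf : Function.Surjective f) :
    Function.Surjective (map f) := by
  intro t
  induction t using TensorSquare.induction with
  | one => exact ⟨1, map_one _⟩
  | tmul g h =>
    obtain ⟨g, rfl⟩ := hf g
    obtain ⟨h, rfl⟩ := hf h
    exact ⟨tmul g h, map_tmul f g h⟩
  | mul s t hs ht =>
    obtain ⟨s, rfl⟩ := hs
    obtain ⟨t, rfl⟩ := ht
    exact ⟨s * t, map_mul _ _ _⟩
  | inv t ht =>
    obtain ⟨t, rfl⟩ := ht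
    exact ⟨t⁻¹, map_inv _ _⟩

end Quotient

end TensorSquare

namespace TensorSquare

open scoped commutatorElement

/-! ### Abelian groups: comparison with the ordinary tensor product -/

section Comm

variable {B : Type*} [CommGroup B]

theorem kappa_eq_one_of_comm (t : TensorSquare B) : kappa t = 1 := by
  induction t using TensorSquare.induction with
  | one => exact map_one _
  | tmul g h => rw [kappa_tmul, commutatorElement_eq_one_iff_mul_comm, mul_comm]
  | mul s t hs ht => rw [map_mul, hs, ht, one_mul]
  | inv t ht => rw [map_inv, ht, inv_one]

theorem mul_comm_of_comm (s t : TensorSquare B) : s * t = t * s :=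
  comm_of_kappa_eq_one (kappa_eq_one_of_comm s) t

theorem mul_tmul_of_comm (g₁ g h : B) : tmul (g₁ * g) h = tmul g₁ h * tmul g h := by
  rw [mul_tmul, act_of_kappa_eq_one (kappa_eq_one_of_comm _), mul_comm_of_comm]

theorem tmul_mul_of_comm (g h₁ h : B) : tmul g (h₁ * h) = tmul g h₁ * tmul g h := by
  rw [tmul_mul, act_of_kappa_eq_one (kappa_eq_one_of_comm _)]

theorem pow_tmul_of_comm (g h : B) (k : ℕ) : tmul (g ^ k) h = tmul g h ^ k := by
  induction k with
  | zero => simp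
  | succ k ih => rw [pow_succ, mul_tmul_of_comm, ih, pow_succ]

theorem pow_card_eq_one_of_comm (t : TensorSquare B) : t ^ Nat.card B = 1 := by
  induction t using TensorSquare.induction with
  | one => exact one_pow _
  | tmul g h => rw [← pow_tmul_of_comm, pow_card_eq_one', one_tmul]
  | mul s t hs ht => rw [Commute.mul_pow (mul_comm_of_comm s t), hs, ht, one_mul]
  | inv t ht => rw [inv_pow, ht, inv_one]

/-- The tensor square of an abelian group is the usual one. -/
noncomputable def equivTensorProduct (B : Type*) [CommGroup B] :
    TensorSquare B ≃* Multiplicative (TensorProduct ℤ (Additive B) (Additive B)) :=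
  letI : CommGroup (TensorSquare B) :=
    { (inferInstance : Group (TensorSquare B)) with mul_comm := mul_comm_of_comm }
  let f : TensorSquare B →* Multiplicative (TensorProduct ℤ (Additive B) (Additive B)) :=
    lift (fun g h => Multiplicative.ofAdd (Additive.ofMul g ⊗ₜ[ℤ] Additive.ofMul h))
      (fun g₁ g h => by
        rw [mul_inv_cancel_comm, mul_inv_cancel_comm, mul_comm g₁, ofMul_mul,
          TensorProduct.add_tmul, ofAdd_add])
      (fun g h₁ h => by
        rw [mul_inv_cancel_comm, mul_inv_cancel_comm, ofMul_mul,
          TensorProduct.tmul_add, ofAdd_add])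
  let g : TensorProduct ℤ (Additive B) (Additive B) →+ Additive (TensorSquare B) :=
    TensorProduct.liftAddHom
      (AddMonoidHom.mk' (fun x => AddMonoidHom.mk'
          (fun y => Additive.ofMul (tmul x.toMul y.toMul))
          (fun y y' => by
            rw [← ofMul_mul]
            exact congrArg _ (tmul_mul_of_comm _ _ _)))
        (fun x x' => by
          ext y
          exact congrArg Additive.ofMul (mul_tmul_of_comm _ _ _)))
      (fun r x y => by
        simp only [AddMonoidHom.mk'_apply]
        have h1 := map_zsmul (AddMonoidHom.mk' (fun x : Additive B =>
          Additive.ofMul (tmul x.toMul y.toMul))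
            (fun y y' => congrArg Additive.ofMul (mul_tmul_of_comm _ _ _))) r x
        have h2 := map_zsmul (AddMonoidHom.mk' (fun y : Additive B =>
          Additive.ofMul (tmul x.toMul y.toMul))
            (fun y y' => congrArg Additive.ofMul (tmul_mul_of_comm _ _ _))) r y
        exact h1.trans h2.symm)
  MonoidHom.toMulEquiv f (AddMonoidHom.toMultiplicativeLeft g)
    (hom_ext fun a b => rfl)
    (by
      apply MonoidHom.ext
      intro x
      induction x using Multiplicative.rec with
      | _ x =>
      induction x using TensorProduct.induction_on with
      | zero => exact map_one _
      | tmul x y => rfl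
      | add x y hx hy => rw [ofAdd_add, map_mul, hx, hy, map_mul])

end Comm

/-! ### Cyclic Hall commutator subgroup -/

section Coprime

variable {G : Type*} [Group G]

/-- The commutator map with values in the commutator subgroup. -/
def kappaRestrict : TensorSquare G →* commutator G := kappa.codRestrict _ kappa_mem

/-- A group with cyclic image under a map with central kernel is abelian; the map here is `kappa`.
-/
theorem mul_comm_of_isCyclic_commutator [IsCyclic (commutator G)] (s t : TensorSquare G) :
    s * t = t * s :=
  (MonoidHom.isMulCommutative_of_isCyclic_of_ker_le_center kappaRestrict (fun t ht => by
    rw [Subgroup.mem_center_iff]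
    intro s
    exact (comm_of_kappa_eq_one (congrArg Subtype.val (MonoidHom.mem_ker.mp ht)) s).symm)).is_comm.comm
    s t

/-- Elements of `G'` act by inner automorphisms of the tensor square, which are trivial here, so the
action factors through `Gᵃᵇ`. -/
theorem act_eq_of_comm (hcomm : ∀ s t : TensorSquare G, s * t = t * s) {x y : G}
    (hxy : (x : G ⧸ commutator G) = y) (t : TensorSquare G) : act x t = act y t := by
  obtain ⟨c, hc⟩ := exists_kappa_eq (QuotientGroup.eq.mp hxy)
  have : y = x * kappa c := by rw [hc]; group
  rw [this, act_mul, act_kappa, hcomm c t, mul_inv_cancel_right]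

/-- Since `G'` acts trivially, `n ↦ n ⊗ g` is a homomorphism on `G'`, so its values inherit the
exponent. -/
theorem pow_eq_one_of_mem_relKer (hcomm : ∀ s t : TensorSquare G, s * t = t * s)
    {t : TensorSquare G} (ht : t ∈ relKer (commutator G)) :
    t ^ Nat.card (commutator G) = 1 := by
  have hl : ∀ n ∈ commutator G, ∀ g, tmul n g ^ Nat.card (commutator G) = 1 := by
    intro n hn g
    have key : ∀ k : ℕ, tmul (n ^ k) g = tmul n g ^ k := by
      intro k
      induction k with
      | zero => simp
      | succ k ih =>
        obtain ⟨s, hs⟩ := exists_kappa_eq (pow_mem hn k)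
        rw [pow_succ, mul_tmul, ← hs, act_kappa, hcomm s, mul_inv_cancel_right, hs, ih, pow_succ']
    have h1 : n ^ Nat.card (commutator G) = 1 :=
      congrArg Subtype.val (pow_card_eq_one' (x := (⟨n, hn⟩ : commutator G)))
    rw [← key, h1, one_tmul]
  unfold relKer at ht
  induction ht using Subgroup.closure_induction with
  | mem t ht =>
    obtain ⟨n, hn, g, rfl | rfl⟩ := ht
    · exact hl n hn g
    · obtain ⟨s, rfl⟩ := exists_kappa_eq hn
      rw [tmul_kappa_eq_inv, inv_pow, hl _ hn, inv_one]
  | one => exact one_pow _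
  | mul s t _ _ hs ht => rw [Commute.mul_pow (hcomm s t), hs, ht, one_mul]
  | inv t _ ht => rw [inv_pow, ht, inv_one]

variable [Finite G]

/-- The norm, the product of the translates over `Gᵃᵇ`, kills every `kappa s ⊗ h = s * (act h s)⁻¹`.
On the kernel of `kappa` the action is trivial, so there the norm is the power by the index. -/
theorem pow_index_eq_one_of_mem_relKer (hcomm : ∀ s t : TensorSquare G, s * t = t * s)
    {t : TensorSquare G} (ht : t ∈ relKer (commutator G)) (hk : kappa t = 1) :
    t ^ (commutator G).index = 1 := by
  classical
  let : CommGroup (TensorSquare G) :=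
    { (inferInstance : Group (TensorSquare G)) with mul_comm := hcomm }
  let := Fintype.ofFinite (G ⧸ commutator G)
  have hgen : ∀ (s : TensorSquare G) (h : G),
      ∏ q : G ⧸ commutator G, act q.out (act h s) = ∏ q : G ⧸ commutator G, act q.out s := by
    intro s h
    rw [← Equiv.prod_comp (Equiv.mulRight (h : G ⧸ commutator G)) fun q => act q.out s]
    refine Finset.prod_congr rfl fun q _ => ?_
    rw [← act_mul]
    exact act_eq_of_comm hcomm (by simp) s
  have hl : ∀ n ∈ commutator G, ∀ g, ∏ q : G ⧸ commutator G, act q.out (tmul n g) = 1 := by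
    intro n hn g
    obtain ⟨s, rfl⟩ := exists_kappa_eq hn
    simp only [kappa_tmul_eq, map_mul, map_inv]
    rw [Finset.prod_mul_distrib, Finset.prod_inv_distrib, hgen, mul_inv_cancel]
  have hnorm : ∏ q : G ⧸ commutator G, act q.out t = 1 := by
    clear hk
    unfold relKer at ht
    induction ht using Subgroup.closure_induction with
    | mem t ht =>
      obtain ⟨n, hn, g, rfl | rfl⟩ := ht
      · exact hl n hn g
      · obtain ⟨s, rfl⟩ := exists_kappa_eq hn
        simp only [tmul_kappa_eq_inv, map_inv]
        rw [Finset.prod_inv_distrib, hl _ hn, inv_one]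
    | one => simp
    | mul s t _ _ hs ht => simp only [map_mul]; rw [Finset.prod_mul_distrib, hs, ht, one_mul]
    | inv t _ ht => simp only [map_inv]; rw [Finset.prod_inv_distrib, ht, inv_one]
  simp only [act_of_kappa_eq_one hk] at hnorm
  rw [Finset.prod_const, Finset.card_univ, ← Nat.card_eq_fintype_card] at hnorm
  exact hnorm

/-- If `G'` is cyclic and a Hall subgroup, then `G ⊗ G ≅ (Gᵃᵇ ⊗ Gᵃᵇ) × G'`. -/
theorem nonempty_equiv_prod_of_coprime [IsCyclic (commutator G)]
    (hco : (Nat.card (commutator G)).Coprime (commutator G).index) :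
    Nonempty (TensorSquare G ≃* TensorSquare (Abelianization G) × commutator G) := by
  have hcomm := mul_comm_of_isCyclic_commutator (G := G)
  let f := (map (Abelianization.of (G := G))).prod (kappaRestrict (G := G))
  have hinj : Function.Injective f := by
    rw [injective_iff_map_eq_one]
    intro t ht
    have h1 : t ∈ relKer (commutator G) := by
      rw [← ker_map_mk']
      exact congrArg Prod.fst ht
    have h2 : kappa t = 1 := congrArg (fun x => (x.2 : G)) ht
    have h3 := pow_eq_one_of_mem_relKer hcomm h1
    have h4 := pow_index_eq_one_of_mem_relKer hcomm h1 h2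
    have h5 := orderOf_dvd_of_pow_eq_one h3
    have h6 := orderOf_dvd_of_pow_eq_one h4
    exact orderOf_eq_one_iff.mp (Nat.eq_one_of_dvd_coprimes hco h5 h6)
  have hsurj : Function.Surjective f := by
    rintro ⟨a, b⟩
    obtain ⟨t, rfl⟩ := map_surjective (f := Abelianization.of (G := G))
      QuotientGroup.mk_surjective a
    obtain ⟨s, hs⟩ := exists_kappa_eq b.2
    have hs' : kappaRestrict s = b := Subtype.ext hs
    subst hs'
    have hm : ∀ x : TensorSquare (Abelianization G), x ^ (commutator G).index = 1 :=
      pow_card_eq_one_of_comm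
    have hn : ∀ x : commutator G, x ^ Nat.card (commutator G) = 1 := fun x => pow_card_eq_one'
    -- The two targets have coprime exponents, so suitable powers act as projections: the `u`-th
    -- power keeps the first coordinate and kills the second, the `v`-th does the reverse.
    obtain ⟨u, hu0, hu1⟩ := Nat.chineseRemainder hco 0 1
    obtain ⟨v, hv1, hv0⟩ := Nat.chineseRemainder hco 1 0
    have e1 : map (Abelianization.of (G := G)) t ^ u = map Abelianization.of t := by
      conv_rhs => rw [← pow_one (map Abelianization.of t)]
      exact pow_eq_pow_iff_modEq.mpr (hu1.of_dvd (orderOf_dvd_of_pow_eq_one (hm _)))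
    have e2 : kappaRestrict t ^ u = 1 := by
      rw [← pow_zero (kappaRestrict t)]
      exact pow_eq_pow_iff_modEq.mpr (hu0.of_dvd (orderOf_dvd_of_pow_eq_one (hn _)))
    have e3 : map (Abelianization.of (G := G)) s ^ v = 1 := by
      rw [← pow_zero (map Abelianization.of s)]
      exact pow_eq_pow_iff_modEq.mpr (hv0.of_dvd (orderOf_dvd_of_pow_eq_one (hm _)))
    have e4 : kappaRestrict s ^ v = kappaRestrict s := by
      conv_rhs => rw [← pow_one (kappaRestrict s)]
      exact pow_eq_pow_iff_modEq.mpr (hv1.of_dvd (orderOf_dvd_of_pow_eq_one (hn _)))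
    refine ⟨t ^ u * s ^ v, ?_⟩
    simp only [f, MonoidHom.prod_apply, map_mul, map_pow, Prod.pow_mk, Prod.mk_mul_mk, e1, e2, e3,
      e4, mul_one, one_mul]
  exact ⟨MulEquiv.ofBijective f ⟨hinj, hsurj⟩⟩

end Coprime

end TensorSquare

/-! ### Finite abelian groups and their tensor squares -/

section

open scoped TensorProduct

/-- `ℤ/N ⊗ ℤ/N ≅ ℤ/N`. -/
noncomputable def ZMod.tensorSelfEquiv (N : ℕ) : ZMod N ⊗[ℤ] ZMod N ≃+ ZMod N where
  toFun := LinearMap.mul' ℤ (ZMod N)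
  invFun x := x ⊗ₜ[ℤ] 1
  map_add' := map_add _
  right_inv x := by simp
  left_inv t := by
    induction t using TensorProduct.induction_on with
    | zero => simp
    | add s t hs ht =>
      beta_reduce at hs ht ⊢
      rw [map_add, TensorProduct.add_tmul, hs, ht]
    | tmul x y =>
      obtain ⟨k, rfl⟩ := ZMod.intCast_surjective y
      have : (k : ZMod N) = k • (1 : ZMod N) := by simp
      beta_reduce
      rw [LinearMap.mul'_apply, this, mul_smul_comm, mul_one, TensorProduct.smul_tmul]

theorem TensorProduct.subsingleton_of_coprime {A M : Type*} [AddCommGroup A] [AddCommGroup M]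
    {a m : ℕ} (ham : a.Coprime m) (hA : ∀ x : A, a • x = 0) (hM : ∀ x : M, m • x = 0) :
    Subsingleton (A ⊗[ℤ] M) := by
  refine subsingleton_of_forall_eq 0 fun t => ?_
  induction t using TensorProduct.induction_on with
  | zero => rfl
  | add s t hs ht => rw [hs, ht, add_zero]
  | tmul x y =>
    have h1 : a • (x ⊗ₜ[ℤ] y) = 0 := by rw [TensorProduct.smul_tmul', hA, TensorProduct.zero_tmul]
    have h2 : m • (x ⊗ₜ[ℤ] y) = 0 := by rw [← TensorProduct.tmul_smul, hM, TensorProduct.tmul_zero]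
    have h3 := addOrderOf_dvd_of_nsmul_eq_zero h1
    have h4 := addOrderOf_dvd_of_nsmul_eq_zero h2
    exact AddMonoid.addOrderOf_eq_one_iff.mp (Nat.eq_one_of_dvd_coprimes ham h3 h4)

/-- The tensor square of `(ℤ/p)² × ℤ/m` for coprime `p` and `m`. -/
theorem ZMod.nonempty_tensorSquare_prod_equiv {p m : ℕ} (h : p.Coprime m) :
    Nonempty (((Fin 2 → ZMod p) × ZMod m) ⊗[ℤ] ((Fin 2 → ZMod p) × ZMod m) ≃+
      (Fin 4 → ZMod p) × ZMod m) := by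
  have hA : ∀ x : Fin 2 → ZMod p, p • x = 0 := fun x => by ext i; simp
  have hM : ∀ x : ZMod m, m • x = 0 := fun x => by simp
  have h1 := TensorProduct.subsingleton_of_coprime h hA hM
  have h2 := TensorProduct.subsingleton_of_coprime h.symm hM hA
  let := uniqueOfSubsingleton (0 : (Fin 2 → ZMod p) ⊗[ℤ] ZMod m)
  let := uniqueOfSubsingleton (0 : ZMod m ⊗[ℤ] (Fin 2 → ZMod p))
  have e0 : (Fin 2 → ZMod p) ⊗[ℤ] (Fin 2 → ZMod p) ≃ₗ[ℤ] (Fin 4 → ZMod p) :=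
    TensorProduct.piRight ℤ ℤ _ _ ≪≫ₗ
      LinearEquiv.piCongrRight (fun _ => TensorProduct.comm ℤ _ _ ≪≫ₗ
        TensorProduct.piRight ℤ ℤ _ _ ≪≫ₗ
        LinearEquiv.piCongrRight fun _ => (ZMod.tensorSelfEquiv p).toIntLinearEquiv) ≪≫ₗ
      (LinearEquiv.curry ℤ (ZMod p) (Fin 2) (Fin 2)).symm ≪≫ₗ
      LinearEquiv.funCongrLeft ℤ (ZMod p) (finProdFinEquiv (m := 2) (n := 2)).symm
  have e1 : ((Fin 2 → ZMod p) × ZMod m) ⊗[ℤ] ((Fin 2 → ZMod p) × ZMod m) ≃ₗ[ℤ]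
      (Fin 4 → ZMod p) × ZMod m :=
    TensorProduct.prodLeft ℤ ℤ _ _ _ ≪≫ₗ
      ((TensorProduct.prodRight ℤ ℤ _ _ _ ≪≫ₗ LinearEquiv.prodUnique (R := ℤ) ≪≫ₗ e0).prodCongr
        (TensorProduct.prodRight ℤ ℤ _ _ _ ≪≫ₗ LinearEquiv.uniqueProd (R := ℤ) ≪≫ₗ
          (ZMod.tensorSelfEquiv m).toIntLinearEquiv))
  exact ⟨e1.toAddEquiv⟩

theorem ZMod.nonempty_linearEquiv_of_card_sq {p : ℕ} [Fact p.Prime] {V : Type*} [AddCommGroup V]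
    [Finite V] [Module (ZMod p) V] (hcard : Nat.card V = p ^ 2) :
    Nonempty (V ≃ₗ[ZMod p] (Fin 2 → ZMod p)) := by
  have hrank : Module.finrank (ZMod p) V = 2 :=
    Nat.pow_right_injective (Fact.out : p.Prime).two_le
      ((FiniteField.pow_finrank_eq_natCard p V).trans hcard)
  exact ⟨(Module.finBasisOfFinrankEq (ZMod p) V hrank).equivFun⟩

/-- A noncyclic abelian group of order `p ^ 2` is elementary. -/
theorem CommGroup.nonempty_equiv_of_card_prime_sq {P : Type*} [CommGroup P] {p : ℕ}
    (hp : p.Prime) (hcard : Nat.card P = p ^ 2) (hcyc : ¬ IsCyclic P) :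
    Nonempty (P ≃* Multiplicative (Fin 2 → ZMod p)) := by
  have : Fact p.Prime := ⟨hp⟩
  have : Finite P := Nat.finite_of_card_ne_zero (by rw [hcard]; exact pow_ne_zero _ hp.ne_zero)
  have hexp : ∀ x : Additive P, p • x = 0 := by
    intro x
    change (x.toMul) ^ p = 1
    rw [← orderOf_dvd_iff_pow_eq_one]
    obtain ⟨k, hk, hk'⟩ := (Nat.dvd_prime_pow hp).mp (hcard ▸ orderOf_dvd_natCard x.toMul)
    have : k ≠ 2 := by
      rintro rfl
      exact hcyc (isCyclic_of_orderOf_eq_card x.toMul (hk'.trans hcard.symm))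
    rw [hk']
    exact (pow_dvd_pow p (show k ≤ 1 by omega)).trans (pow_one p).dvd
  let := AddCommGroup.zmodModule hexp
  have : Finite (Additive P) := ‹Finite P›
  obtain ⟨e⟩ := ZMod.nonempty_linearEquiv_of_card_sq (V := Additive P) hcard
  exact ⟨AddEquiv.toMultiplicativeRight e.toAddEquiv⟩

/-- The complement of the subgroup of order `p ^ 2` has squarefree order, hence is cyclic; all
noncyclicity then sits in the `p`-part, which must be elementary. -/
theorem CommGroup.nonempty_equiv_of_card {B : Type*} [CommGroup B] {p m : ℕ}
    (hp : p.Prime) (hm : Squarefree m) (hpm : p.Coprime m) (hcard : Nat.card B = p ^ 2 * m)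
    (hcyc : ¬ IsCyclic B) :
    Nonempty (B ≃* Multiplicative ((Fin 2 → ZMod p) × ZMod m)) := by
  have : Fact p.Prime := ⟨hp⟩
  have : NeZero m := ⟨hm.ne_zero⟩
  have : Finite B := Nat.finite_of_card_ne_zero (by
    rw [hcard]; exact mul_ne_zero (pow_ne_zero _ hp.ne_zero) hm.ne_zero)
  obtain ⟨P, hP⟩ := Sylow.exists_subgroup_card_pow_prime (G := B) p (n := 2) ⟨m, hcard⟩
  have hPi : P.index = m := by
    have := P.card_mul_index
    rw [hP, hcard] at this
    exact Nat.eq_of_mul_eq_mul_left (pow_pos hp.pos 2) this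
  obtain ⟨M, hM⟩ := Subgroup.exists_right_complement'_of_coprime (N := P)
    (by rw [hP, hPi]; exact Nat.Coprime.pow_left 2 hpm)
  have hMc : Nat.card M = m := by
    have := hM.card_mul_card
    rw [hP, hcard] at this
    exact Nat.eq_of_mul_eq_mul_left (pow_pos hp.pos 2) this
  let e : P × M ≃* B := MulEquiv.ofBijective (P.subtype.coprod M.subtype) hM
  have : IsZGroup M := IsZGroup.of_squarefree (by rw [hMc]; exact hm)
  have hMcyc : IsCyclic M := inferInstance
  have hPcyc : ¬ IsCyclic P := by
    intro h
    apply hcyc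
    have : IsCyclic (P × M) := Group.isCyclic_prod_iff.mpr ⟨h, hMcyc, by
      rw [hP, hMc]; exact Nat.Coprime.pow_left 2 hpm⟩
    exact isCyclic_of_surjective e e.surjective
  obtain ⟨eP⟩ := CommGroup.nonempty_equiv_of_card_prime_sq hp hP hPcyc
  have eM : M ≃* Multiplicative (ZMod m) := mulEquivOfCyclicCardEq (by simp [hMc])
  exact ⟨e.symm.trans ((eP.prodCongr eM).trans (MulEquiv.prodMultiplicative _ _).symm)⟩

namespace TensorSquare

theorem nonempty_equiv_of_isCyclic {B : Type*} [CommGroup B] [IsCyclic B] :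
    Nonempty (TensorSquare B ≃* Multiplicative (ZMod (Nat.card B))) :=
  ⟨((congr (zmodCyclicMulEquiv inferInstance).symm).trans (equivTensorProduct _)).trans
    (AddEquiv.toMultiplicative (ZMod.tensorSelfEquiv (Nat.card B)))⟩

theorem nonempty_equiv_of_not_isCyclic {B : Type*} [CommGroup B] {p m : ℕ}
    (hp : p.Prime) (hm : Squarefree m) (hpm : p.Coprime m) (hcard : Nat.card B = p ^ 2 * m)
    (hcyc : ¬ IsCyclic B) :
    Nonempty (TensorSquare B ≃* Multiplicative (Fin 4 → ZMod p) × Multiplicative (ZMod m)) := by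
  obtain ⟨e⟩ := CommGroup.nonempty_equiv_of_card hp hm hpm hcard hcyc
  obtain ⟨f⟩ := ZMod.nonempty_tensorSquare_prod_equiv hpm
  exact ⟨(((congr e).trans (equivTensorProduct _)).trans
    (AddEquiv.toMultiplicative f)).trans (MulEquiv.prodMultiplicative _ _)⟩

end TensorSquare

end

/-! ### Transfer, centralizers and cyclic commutator subgroups -/

section GroupTheory

open Subgroup

open scoped commutatorElement

variable {G : Type*} [Group G]

/-- An `ℓ`-group normalizing `S` centralizes `S` if the order of `S` forces the fixed points to be
everything. -/
theorem Subgroup.conj_eq_of_isPGroup [Finite G] {ℓ : ℕ} [Fact ℓ.Prime] {S : Subgroup G}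
    {L : Subgroup (normalizer (S : Set G))} (hL : IsPGroup ℓ L)
    (h : ∀ d, d ∣ Nat.card S → Nat.card S ≡ d [MOD ℓ] → d = Nat.card S)
    {l : normalizer (S : Set G)} (hl : l ∈ L) {s : G} (hs : s ∈ S) : (l : G) * s * (l : G)⁻¹ = s := by
  have h1 := hL.card_modEq_card_fixedPoints S
  have h2 : Nat.card (MulAction.fixedPoints L S) = Nat.card (FixedPoints.subgroup L S) := rfl
  have h3 := h _ (FixedPoints.subgroup L S).card_subgroup_dvd_card (h2 ▸ h1)
  have h4 : FixedPoints.subgroup L S = ⊤ := Subgroup.eq_top_of_card_eq _ h3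
  have h5 : (⟨s, hs⟩ : S) ∈ FixedPoints.subgroup L S := h4 ▸ Subgroup.mem_top _
  exact congrArg Subtype.val (h5 ⟨l, hl⟩)

theorem Subgroup.le_of_coprime_index {H K : Subgroup G} [H.Normal]
    (h : (Nat.card K).Coprime H.index) : K ≤ H := by
  intro x hx
  rw [← QuotientGroup.eq_one_iff]
  have h1 : (x : G ⧸ H) ^ Nat.card K = 1 := by
    rw [← QuotientGroup.mk_pow]
    have : x ^ Nat.card K = 1 := congrArg Subtype.val (pow_card_eq_one' (x := (⟨x, hx⟩ : K)))
    rw [this, QuotientGroup.mk_one]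
  have h2 : (x : G ⧸ H) ^ H.index = 1 := pow_card_eq_one'
  exact orderOf_eq_one_iff.mp (Nat.eq_one_of_dvd_coprimes h (orderOf_dvd_of_pow_eq_one h1)
    (orderOf_dvd_of_pow_eq_one h2))

/-- Burnside's transfer gives a normal complement of `P` whose quotient is abelian, so `G'` lies in
a subgroup of order `P.index`. -/
theorem Sylow.card_commutator_dvd_index [Finite G] {p : ℕ} [Fact p.Prime] (P : Sylow p G)
    (hP : normalizer (P : Set G) ≤ centralizer (P : Set G)) :
    Nat.card (commutator G) ∣ P.index := by
  have hc := MonoidHom.ker_transferSylow_isComplement' P hP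
  have hle : commutator G ≤ (MonoidHom.transferSylow P hP).ker :=
    Subgroup.Normal.commutator_le_of_self_sup_commutative_eq_top (H := P) hc.sup_eq_top
      ⟨⟨fun a b => Subtype.ext (hP (le_normalizer b.2) a a.2)⟩⟩
  rw [hc.index_eq_card]
  exact Subgroup.card_dvd_of_le hle

/-- In a group of order `p² * m` with `m` prime to `p + 1` and only with prime divisors larger than
`p`, the Sylow `p`-subgroups are in the centre of their normalizers. -/
theorem Sylow.normalizer_le_centralizer_of_card [Finite G] {p m : ℕ} [hp : Fact p.Prime]
    (hcard : Nat.card G = p ^ 2 * m) (hm : ∀ ℓ, ℓ.Prime → ℓ ∣ m → p < ℓ ∧ ¬ ℓ ∣ p + 1)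
    (P : Sylow p G) (hPcard : Nat.card P = p ^ 2) :
    normalizer (P : Set G) ≤ centralizer (P : Set G) := by
  rw [← Subgroup.relIndex_eq_one]
  by_contra hne
  obtain ⟨ℓ, hℓ, hdvd⟩ := Nat.exists_prime_and_dvd hne
  have : Fact ℓ.Prime := ⟨hℓ⟩
  have hcomm : IsMulCommutative P := IsPGroup.isMulCommutative_of_card_eq_prime_sq hPcard
  have hPC : (P : Subgroup G) ≤ centralizer (P : Set G) := by
    intro x hx y hy
    exact congrArg Subtype.val (mul_comm' (⟨y, hy⟩ : P) ⟨x, hx⟩)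
  have hind : P.index = m := by
    have := P.card_mul_index
    rw [hcard] at this
    change Nat.card P * _ = _ at this
    rw [hPcard] at this
    exact Nat.eq_of_mul_eq_mul_left (pow_pos hp.out.pos 2) this
  have hℓm : ℓ ∣ m := by
    rw [← hind]
    exact hdvd.trans ((Subgroup.relIndex_dvd_of_le_left _ hPC).trans
      (Subgroup.relIndex_dvd_index_of_le le_normalizer))
  obtain ⟨hpl, hp1⟩ := hm ℓ hℓ hℓm
  -- If a Sylow `ℓ`-subgroup of the normalizer centralizes `P`, then `ℓ` cannot divide the index of
  -- the centralizer. It does so once its fixed points on `P`, of order `1`, `p` or `p²`, are forced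
  -- to be everything by counting modulo `ℓ`: `ℓ` divides neither `p² - 1` nor `p² - p`.
  obtain ⟨L⟩ := (inferInstance : Nonempty (Sylow ℓ (normalizer (P : Set G))))
  refine L.not_dvd_index (hdvd.trans (Subgroup.index_dvd_of_le ?_))
  intro l hl
  rw [Subgroup.mem_subgroupOf]
  intro s hs
  refine (mul_inv_eq_iff_eq_mul.mp (Subgroup.conj_eq_of_isPGroup (S := (P : Subgroup G))
    L.isPGroup' ?_ hl hs)).symm
  intro d hd hmod
  change d ∣ Nat.card P at hd
  change Nat.card P ≡ d [MOD ℓ] at hmod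
  rw [hPcard] at hd hmod ⊢
  obtain ⟨k, hk, rfl⟩ := (Nat.dvd_prime_pow hp.out).mp hd
  have hdiv := (Nat.modEq_iff_dvd' (pow_le_pow_right₀ hp.out.one_le hk)).mp hmod.symm
  have hnd : ¬ ℓ ∣ p - 1 := fun h => by
    have := Nat.le_of_dvd (by have := hp.out.two_le; omega) h
    omega
  interval_cases k
  · exfalso
    rw [pow_zero, ← one_pow 2, Nat.sq_sub_sq, hℓ.dvd_mul] at hdiv
    exact hdiv.elim hp1 hnd
  · exfalso
    rw [pow_one, sq, ← Nat.mul_sub_one, hℓ.dvd_mul] at hdiv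
    refine hdiv.elim (fun h => ?_) hnd
    have := Nat.le_of_dvd hp.out.pos h
    omega
  · rfl

/-- A Sylow subgroup of order `4` which is not in the centre of its normalizer lies in the
commutator subgroup. -/
theorem Sylow.le_commutator_of_card_eq_four [Finite G] (P : Sylow 2 G) (hPcard : Nat.card P = 4)
    (hP : ¬ normalizer (P : Set G) ≤ centralizer (P : Set G)) :
    (P : Subgroup G) ≤ commutator G := by
  have hcomm : IsMulCommutative P :=
    IsPGroup.isMulCommutative_of_card_eq_prime_sq (p := 2) (by rw [hPcard]; rfl)
  have hPC : (P : Subgroup G) ≤ centralizer (P : Set G) := by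
    intro x hx y hy
    exact congrArg Subtype.val (mul_comm' (⟨y, hy⟩ : P) ⟨x, hx⟩)
  by_contra hle
  apply hP
  let A : Subgroup G := (P : Subgroup G) ⊓ commutator G
  have hA : Nat.card A ≤ 2 := by
    have h1 : A < P := lt_of_le_of_ne inf_le_left fun h => hle (inf_eq_left.mp h)
    have h2 : Nat.card A ∣ 2 ^ 2 := by
      have := Subgroup.card_dvd_of_le h1.le
      change _ ∣ Nat.card P at this
      rwa [hPcard] at this
    have h3 : Nat.card A ≠ 4 := by
      intro h
      apply h1.ne
      apply Subgroup.eq_of_le_of_card_ge h1.le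
      rw [h, hPcard]
    obtain ⟨k, hk, hk'⟩ := (Nat.dvd_prime_pow Nat.prime_two).mp h2
    interval_cases k <;> omega
  have hA2 : ∀ a ∈ A, ∀ b ∈ A, a ≠ 1 → b ≠ 1 → a = b := by
    intro a ha b hb ha1 hb1
    by_contra hab
    have : Function.Injective (![⟨1, one_mem A⟩, ⟨a, ha⟩, ⟨b, hb⟩] : Fin 3 → A) := by
      intro i j hij
      fin_cases i <;> fin_cases j <;> simp_all [Subtype.ext_iff]
    have h3 := Nat.card_le_card_of_injective _ this
    rw [Nat.card_fin] at h3
    omega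
  have hAsq : ∀ a ∈ A, a * a = 1 := by
    intro a ha
    by_contra h
    have h1 : a ≠ 1 := by rintro rfl; simp at h
    have := hA2 a ha _ (mul_mem ha ha) h1 h
    exact h1 (left_eq_mul.mp this)
  -- The commutator of `n` with `x ∈ P` lies in `A`, which has at most one nontrivial element; so it
  -- is fixed by `n` and squares to `1`, whence `n²` centralizes `P`. The quotient of the normalizer
  -- by the centralizer has odd order, so `n` itself centralizes `P`.
  have hsq : ∀ n ∈ normalizer (P : Set G), n * n ∈ centralizer (P : Set G) := by
    intro n hn x hx
    have hx' : n * x * n⁻¹ ∈ P := (hn x).mp hx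
    have ha : n * x * n⁻¹ * x⁻¹ ∈ A :=
      ⟨mul_mem (S := Subgroup G) hx' (inv_mem hx),
        Subgroup.commutator_mem_commutator (mem_top n) (mem_top x)⟩
    have hna : n * (n * x * n⁻¹ * x⁻¹) * n⁻¹ = n * x * n⁻¹ * x⁻¹ := by
      by_cases h1 : n * x * n⁻¹ * x⁻¹ = 1
      · rw [h1]; group
      · refine hA2 _ ⟨(hn _).mp ha.1, Subgroup.Normal.conj_mem inferInstance _ ha.2 n⟩ _ ha ?_ h1
        rwa [Ne, conj_eq_one_iff]
    have h2 := hAsq _ ha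
    have h3 : n * n * x * (n * n)⁻¹ =
        n * (n * x * n⁻¹ * x⁻¹) * n⁻¹ * (n * x * n⁻¹ * x⁻¹) * x := by group
    rw [hna, h2, one_mul, mul_inv_eq_iff_eq_mul] at h3
    exact h3.symm
  intro n hn
  let C := (centralizer (P : Set G)).subgroupOf (normalizer (P : Set G))
  have hodd : ¬ 2 ∣ C.index := fun h => P.not_dvd_index
    (h.trans ((Subgroup.relIndex_dvd_of_le_left _ hPC).trans
      (Subgroup.relIndex_dvd_index_of_le le_normalizer)))
  have h1 : ((⟨n, hn⟩ : normalizer (P : Set G)) : _ ⧸ C) ^ 2 = 1 := by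
    rw [← QuotientGroup.mk_pow, QuotientGroup.eq_one_iff, sq]
    exact hsq n hn
  have h2 : ((⟨n, hn⟩ : normalizer (P : Set G)) : _ ⧸ C) ^ C.index = 1 := pow_card_eq_one'
  have h3 := orderOf_eq_one_iff.mp (Nat.eq_one_of_dvd_coprimes
    ((Nat.Prime.coprime_iff_not_dvd Nat.prime_two).mpr hodd)
    (orderOf_dvd_of_pow_eq_one h1) (orderOf_dvd_of_pow_eq_one h2))
  exact Subgroup.mem_subgroupOf.mp ((QuotientGroup.eq_one_iff (N := C) _).mp h3)

/-- Endomorphisms of a cyclic group are power maps and commute, so commutators act trivially by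
conjugation. -/
theorem Subgroup.commutator_le_centralizer_of_isCyclic (N : Subgroup G) [N.Normal] [IsCyclic N] :
    _root_.commutator G ≤ centralizer (N : Set G) := by
  rw [_root_.commutator_def, Subgroup.commutator_le]
  intro g _ h _ n hn
  have key : MulAut.conjNormal (H := N) ⁅g, h⁆ = 1 := by
    rw [map_commutatorElement, commutatorElement_eq_one_iff_mul_comm]
    ext x : 1
    obtain ⟨a, ha⟩ := (MulAut.conjNormal (H := N) g).toMonoidHom.map_cyclic
    obtain ⟨b, hb⟩ := (MulAut.conjNormal (H := N) h).toMonoidHom.map_cyclic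
    change (MulAut.conjNormal g).toMonoidHom ((MulAut.conjNormal h).toMonoidHom x) =
      (MulAut.conjNormal h).toMonoidHom ((MulAut.conjNormal g).toMonoidHom x)
    rw [ha, hb, hb, ha, ← zpow_mul, ← zpow_mul, mul_comm]
  have h1 : ((MulAut.conjNormal (H := N) ⁅g, h⁆ ⟨n, hn⟩ : N) : G) = n := by rw [key]; rfl
  rw [MulAut.conjNormal_apply, mul_inv_eq_iff_eq_mul] at h1
  exact h1.symm

-- `G''` is cyclic and normal in `G`, so it is centralized by `G'`; as `G' / G''` is cyclic, `G'` is
-- abelian, and a nilpotent Z-group is cyclic.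
open scoped IsMulCommutative in
theorem isCyclic_commutator_of_isZGroup [Finite G] [IsZGroup (commutator G)] :
    IsCyclic (commutator G) := by
  let D : Subgroup G := (commutator (commutator G)).map (commutator G).subtype
  have hD : IsCyclic D := by
    have := IsZGroup.isCyclic_commutator (G := commutator G)
    exact isCyclic_of_surjective _
      ((commutator G).subtype.subgroupMap_surjective (commutator (commutator G)))
  have hle := D.commutator_le_centralizer_of_isCyclic
  have : IsCyclic (Abelianization (commutator G)) := IsZGroup.isCyclic_abelianization
  have hcomm : IsMulCommutative (commutator G) :=
    MonoidHom.isMulCommutative_of_isCyclic_of_ker_le_center Abelianization.of (by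
      rw [Abelianization.ker_of]
      intro x hx
      rw [Subgroup.mem_center_iff]
      intro y
      exact Subtype.ext (hle y.2 x ⟨x, hx, rfl⟩).symm)
  have : Group.IsNilpotent (commutator G) := CommGroup.isNilpotent (G := commutator G)
  infer_instance

end GroupTheory

/-! ### Groups of order `12r` -/

section GroupTheory

open Subgroup

variable {G : Type*} [Group G] [Finite G]

theorem Sylow.card_eq_of_card_eq {p k m : ℕ} [hp : Fact p.Prime] (hcard : Nat.card G = p ^ k * m)
    (hm : ¬ p ∣ m) (P : Sylow p G) : Nat.card P = p ^ k := by
  rw [P.card_eq_multiplicity, hcard, Nat.factorization_mul (pow_ne_zero _ hp.out.ne_zero)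
    (by rintro rfl; exact hm (dvd_zero p))]
  simp [hp.out.factorization_self, Nat.factorization_eq_zero_of_not_dvd hm]

/-- There are one or four Sylow 3-subgroups. A single one has abelian quotient of order 4; otherwise
they are self-normalizing and transfer makes `|G'|` divide 4. -/
theorem commutator_ne_top_of_card_eq_twelve (hcard : Nat.card G = 12) : commutator G ≠ ⊤ := by
  intro htop
  have : Fact (Nat.Prime 3) := ⟨Nat.prime_three⟩
  let S : Sylow 3 G := default
  have hS : Nat.card S = 3 := S.card_eq_of_card_eq (k := 1) (m := 4) hcard (by norm_num)
  have hSi : S.index = 4 := by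
    have := (S : Subgroup G).card_mul_index
    change Nat.card S * _ = _ at this
    rw [hcard, hS] at this
    omega
  have hC : Nat.card (commutator G) = 12 := by rw [htop, Subgroup.card_top, hcard]
  have h1 := card_sylow_modEq_one 3 G
  have h2 : Nat.card (Sylow 3 G) ∣ 2 ^ 2 := by
    have := S.card_dvd_index
    rwa [hSi] at this
  obtain ⟨k, hk, hk'⟩ := (Nat.dvd_prime_pow Nat.prime_two).mp h2
  have h3 := S.card_eq_index_normalizer
  have h4 := (normalizer (S : Set G)).card_mul_index
  rw [hk'] at h1 h3
  rw [← h3, hcard] at h4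
  interval_cases k
  · have hN : (S : Subgroup G).Normal :=
      Subgroup.normalizer_eq_top_iff.mp (Subgroup.index_eq_one.mp h3.symm)
    have hq : Nat.card (G ⧸ (S : Subgroup G)) = 2 ^ 2 := hSi
    have hle : commutator G ≤ S := Subgroup.Normal.quotient_commutative_iff_commutator_le.mp
      (IsPGroup.isMulCommutative_of_card_eq_prime_sq hq)
    have := Subgroup.card_le_of_le hle
    change _ ≤ Nat.card S at this
    omega
  · norm_num [Nat.ModEq] at h1
  · have hN : (S : Subgroup G) = normalizer (S : Set G) := by
      have : Nat.card (normalizer (S : Set G)) = 3 := by omega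
      exact Subgroup.eq_of_le_of_card_ge le_normalizer (this.trans hS.symm).le
    have hcyc : IsCyclic S := isCyclic_of_prime_card hS
    have hle : normalizer (S : Set G) ≤ centralizer (S : Set G) := by
      rw [← hN]
      intro x hx y hy
      exact congrArg Subtype.val (mul_comm' (⟨y, hy⟩ : S) ⟨x, hx⟩)
    have := S.card_commutator_dvd_index hle
    rw [hSi, hC] at this
    norm_num at this

/-- If the Sylow `ℓ`-subgroup `P` lies in a normal subgroup `H` of prime index `r`, and `P` has
fewer than `r` elements, then `P` is isomorphic to a subgroup of the normalizer of any Sylow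
`r`-subgroup of order `r`. -/
theorem Sylow.card_dvd_card_normalizer {ℓ r : ℕ} [Fact ℓ.Prime] [hr : Fact r.Prime]
    {H : Subgroup G} [H.Normal] (hH : H.index = r) (P : Sylow ℓ G) (hPH : (P : Subgroup G) ≤ H)
    (hPr : Nat.card P < r) (R : Sylow r G) (hR : Nat.card R = r) :
    Nat.card P ∣ Nat.card (normalizer (R : Set G)) := by
  -- Frattini's argument: the normalizer of `P` surjects onto `G / H`, hence contains a subgroup of
  -- order `r`. This centralizes `P`, because the number of fixed points is congruent to `|P| < r`
  -- modulo `r`.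
  have hsup := P.normalizer_sup_eq_top' hPH
  have hrdvd : r ∣ Nat.card (normalizer (P : Set G)) := by
    have h1 : H.relIndex (normalizer (P : Set G)) = r := by
      rw [← Subgroup.relIndex_sup_right _ H, hsup, Subgroup.relIndex_top_right, hH]
    rw [← h1]
    exact Subgroup.relIndex_dvd_card _ _
  obtain ⟨L, hL⟩ := Sylow.exists_subgroup_card_pow_prime (G := normalizer (P : Set G)) r (n := 1)
    (by rwa [pow_one])
  let R₁ : Subgroup G := L.map (normalizer (P : Set G)).subtype
  have hR₁ : Nat.card R₁ = r := by
    rw [Subgroup.card_map_of_injective (Subgroup.subtype_injective _), hL, pow_one]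
  have hconj : ∀ x ∈ R₁, ∀ s ∈ P, x * s = s * x := by
    rintro _ ⟨l, hl, rfl⟩ s hs
    refine mul_inv_eq_iff_eq_mul.mp (Subgroup.conj_eq_of_isPGroup (S := (P : Subgroup G))
      (IsPGroup.of_card hL) ?_ hl hs)
    intro d hd hmod
    have h1 : d ≤ Nat.card P := Nat.le_of_dvd Nat.card_pos hd
    exact (Nat.ModEq.eq_of_lt_of_lt hmod hPr (h1.trans_lt hPr)).symm
  have hle : (P : Subgroup G) ≤ normalizer (R₁ : Set G) := by
    intro s hs
    rw [Subgroup.mem_normalizer_iff]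
    intro x
    constructor
    · intro hx
      rwa [← hconj x hx s hs, mul_inv_cancel_right]
    · intro hx
      have h1 := hconj _ hx s hs
      have h2 : s * x * s⁻¹ = x := by
        have h3 : s * (s * x * s⁻¹) = s * x := by rw [← h1]; group
        exact mul_left_cancel h3
      rwa [h2] at hx
  have hfac : r ^ (Nat.card G).factorization r = r := by rw [← R.card_eq_multiplicity, hR]
  let R₂ : Sylow r G := Sylow.ofCard R₁ (by rw [hR₁, hfac])
  have hind : (normalizer (R : Set G)).index = (normalizer (R₁ : Set G)).index :=
    R.card_eq_index_normalizer.symm.trans R₂.card_eq_index_normalizer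
  have hcard : Nat.card (normalizer (R : Set G)) = Nat.card (normalizer (R₁ : Set G)) := by
    have h1 := (normalizer (R : Set G)).card_mul_index
    have h2 := (normalizer (R₁ : Set G)).card_mul_index
    rw [hind, ← h2] at h1
    exact Nat.eq_of_mul_eq_mul_right (Nat.pos_of_ne_zero Subgroup.index_ne_zero_of_finite) h1
  rw [hcard]
  exact Subgroup.card_dvd_of_le hle

/-- If `|G'| = 12`, then `G'` has index `r` and contains Sylow subgroups of orders `4` and `3`, both
below `r`. By `Sylow.card_dvd_card_normalizer` a Sylow `r`-subgroup `R` is then normal, and `G' R =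
G` makes `G / R` a perfect group of order 12. -/
theorem card_commutator_ne_twelve {r : ℕ} (hr : r.Prime) (hr5 : 5 ≤ r)
    (hcard : Nat.card G = 12 * r) : Nat.card (commutator G) ≠ 12 := by
  intro h12
  have : Fact r.Prime := ⟨hr⟩
  have : Fact (Nat.Prime 3) := ⟨Nat.prime_three⟩
  have hr2 : ¬ 2 ∣ r := fun h => by have := (Nat.prime_dvd_prime_iff_eq Nat.prime_two hr).mp h; omega
  have hr3 : ¬ 3 ∣ r := fun h => by
    have := (Nat.prime_dvd_prime_iff_eq Nat.prime_three hr).mp h; omega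
  have hr12 : ¬ r ∣ 12 := by
    rw [show 12 = 2 * 2 * 3 by norm_num, hr.dvd_mul, hr.dvd_mul]
    rintro ((h | h) | h) <;> have := Nat.le_of_dvd (by norm_num) h <;> omega
  have hcop : Nat.Coprime 12 r := ((Nat.Prime.coprime_iff_not_dvd hr).mpr hr12).symm
  have hind : (commutator G).index = r := by
    have := (commutator G).card_mul_index
    rw [h12, hcard] at this
    omega
  let R : Sylow r G := default
  have hR : Nat.card R = r := by
    rw [R.card_eq_of_card_eq (k := 1) (m := 12) (by rw [hcard]; ring) hr12, pow_one]
  let P : Sylow 2 G := default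
  have hP : Nat.card P = 4 :=
    P.card_eq_of_card_eq (k := 2) (m := 3 * r) (by rw [hcard]; ring) (by
      rw [Nat.prime_two.dvd_mul]; omega)
  let S : Sylow 3 G := default
  have hS : Nat.card S = 3 :=
    S.card_eq_of_card_eq (k := 1) (m := 4 * r) (by rw [hcard]; ring) (by
      rw [Nat.prime_three.dvd_mul]; omega)
  have hPH : (P : Subgroup G) ≤ commutator G := Subgroup.le_of_coprime_index (by
    rw [hP, hind]
    exact Nat.Coprime.coprime_dvd_left (by norm_num) hcop)
  have hSH : (S : Subgroup G) ≤ commutator G := Subgroup.le_of_coprime_index (by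
    rw [hS, hind]
    exact Nat.Coprime.coprime_dvd_left (by norm_num) hcop)
  have h4 := P.card_dvd_card_normalizer hind hPH (by omega) R hR
  have h3 := S.card_dvd_card_normalizer hind hSH (by omega) R hR
  rw [hP] at h4
  rw [hS] at h3
  have hrN : r ∣ Nat.card (normalizer (R : Set G)) := by
    have := Subgroup.card_dvd_of_le (le_normalizer (H := (R : Subgroup G)))
    change Nat.card R ∣ _ at this
    rwa [hR] at this
  have h12r : 12 * r ∣ Nat.card (normalizer (R : Set G)) :=
    hcop.mul_dvd_of_dvd_of_dvd (Nat.Coprime.mul_dvd_of_dvd_of_dvd (by norm_num) h4 h3) hrN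
  have hRn : (R : Subgroup G).Normal := by
    rw [← Subgroup.normalizer_eq_top_iff]
    apply Subgroup.eq_top_of_le_card
    rw [hcard]
    exact Nat.le_of_dvd Nat.card_pos h12r
  have hq : Nat.card (G ⧸ (R : Subgroup G)) = 12 := by
    have := (R : Subgroup G).card_mul_index
    change Nat.card R * _ = _ at this
    rw [hR, hcard, mul_comm] at this
    exact Nat.eq_of_mul_eq_mul_right hr.pos this
  apply commutator_ne_top_of_card_eq_twelve hq
  let f := QuotientGroup.mk' (R : Subgroup G)
  let M := (commutator (G ⧸ (R : Subgroup G))).comap f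
  have hM1 : commutator G ≤ M := by
    rw [← Subgroup.map_le_iff_le_comap, commutator_def, Subgroup.map_commutator, commutator_def]
    exact Subgroup.commutator_mono le_top le_top
  have hM2 : (R : Subgroup G) ≤ M := by
    intro x hx
    change f x ∈ commutator (G ⧸ (R : Subgroup G))
    rw [show f x = 1 from (QuotientGroup.eq_one_iff x).mpr hx]
    exact one_mem _
  have hM : M = ⊤ := by
    apply Subgroup.eq_top_of_le_card
    rw [hcard]
    refine Nat.le_of_dvd Nat.card_pos (hcop.mul_dvd_of_dvd_of_dvd ?_ ?_)
    · exact h12 ▸ Subgroup.card_dvd_of_le hM1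
    · have := Subgroup.card_dvd_of_le hM2
      change Nat.card R ∣ _ at this
      rwa [hR] at this
  rw [eq_top_iff]
  intro x _
  obtain ⟨g, rfl⟩ := QuotientGroup.mk'_surjective _ x
  have : g ∈ M := hM ▸ Subgroup.mem_top g
  exact this

/-- Either transfer applies to a Sylow 2-subgroup and `|G'|` divides `3r`, or that subgroup lies in
`G'` and `4` divides `|G'|`. -/
theorem card_commutator_of_card_eq_twelve_mul {r : ℕ} (hr : r.Prime) (hr5 : 5 ≤ r)
    (hcard : Nat.card G = 12 * r) (hbot : commutator G ≠ ⊥) (htop : commutator G ≠ ⊤) :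
    Nat.card (commutator G) = 3 ∨ Nat.card (commutator G) = r ∨
      Nat.card (commutator G) = 3 * r ∨ Nat.card (commutator G) = 4 ∨
      Nat.card (commutator G) = 4 * r := by
  have hr2 : ¬ 2 ∣ r := fun h => by have := (Nat.prime_dvd_prime_iff_eq Nat.prime_two hr).mp h; omega
  have hdiv : ∀ d, d ∣ 3 * r → d = 1 ∨ d = 3 ∨ d = r ∨ d = 3 * r := by
    intro d hd
    obtain ⟨a, b, ha, hb, rfl⟩ := Nat.dvd_mul.mp hd |>.imp fun a h => h.imp fun b h => h
    rcases (Nat.dvd_prime Nat.prime_three).mp ha with rfl | rfl <;>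
      rcases (Nat.dvd_prime hr).mp hb with rfl | rfl <;> simp
  have h1 : Nat.card (commutator G) ≠ 1 := fun h => hbot (Subgroup.card_eq_one.mp h)
  have h12 := card_commutator_ne_twelve hr hr5 hcard
  have h12r : Nat.card (commutator G) ≠ 12 * r := fun h =>
    htop (Subgroup.eq_top_of_card_eq _ (h.trans hcard.symm))
  let P : Sylow 2 G := default
  have hP : Nat.card P = 4 :=
    P.card_eq_of_card_eq (k := 2) (m := 3 * r) (by rw [hcard]; ring) (by
      rw [Nat.prime_two.dvd_mul]; omega)
  by_cases hN : normalizer (P : Set G) ≤ centralizer (P : Set G)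
  · have h := P.card_commutator_dvd_index hN
    have hi : P.index = 3 * r := by
      have := (P : Subgroup G).card_mul_index
      change Nat.card P * _ = _ at this
      rw [hP, hcard] at this
      omega
    rw [hi] at h
    rcases hdiv _ h with h | h | h | h <;> simp_all
  · have h4 := Subgroup.card_dvd_of_le (P.le_commutator_of_card_eq_four hP hN)
    change Nat.card P ∣ _ at h4
    rw [hP] at h4
    obtain ⟨k, hk⟩ := h4
    have hk' : k ∣ 3 * r := by
      have := (commutator G).card_subgroup_dvd_card
      rw [hk, hcard, show 12 * r = 4 * (3 * r) by ring] at this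
      exact Nat.dvd_of_mul_dvd_mul_left (by norm_num) this
    rcases hdiv _ hk' with rfl | rfl | rfl | rfl <;> omega

/-- When `|G'| = 4r`, the Sylow `r`-subgroup of `G'` is unique since `r ≥ 5`. Being cyclic and
normal in `G`, it is central in `G'`, so `G'` is nilpotent and its Sylow 2-subgroup is
characteristic. -/
theorem exists_normal_card_eq_four {r : ℕ} (hr : r.Prime) (hr5 : 5 ≤ r)
    (hcard : Nat.card (commutator G) = 4 ∨ Nat.card (commutator G) = 4 * r) :
    ∃ V : Subgroup G, V.Normal ∧ Nat.card V = 4 ∧ V ≤ commutator G := by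
  rcases hcard with hcard | hcard
  · exact ⟨commutator G, inferInstance, hcard, le_rfl⟩
  have : Fact r.Prime := ⟨hr⟩
  have hr2 : ¬ 2 ∣ r := fun h => by have := (Nat.prime_dvd_prime_iff_eq Nat.prime_two hr).mp h; omega
  have hr4 : ¬ r ∣ 4 := fun h => by have := Nat.le_of_dvd (by norm_num) h; omega
  let R : Sylow r (commutator G) := default
  have hR : Nat.card R = r := by
    rw [R.card_eq_of_card_eq (k := 1) (m := 4) (by rw [hcard]; ring) hr4, pow_one]
  have hRi : R.index = 4 := by
    have := (R : Subgroup (commutator G)).card_mul_index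
    change Nat.card R * _ = _ at this
    rw [hR, hcard, mul_comm] at this
    exact Nat.eq_of_mul_eq_mul_right hr.pos this
  have hsub : Subsingleton (Sylow r (commutator G)) := by
    have h1 := card_sylow_modEq_one r (commutator G)
    have h2 : Nat.card (Sylow r (commutator G)) ≤ 4 :=
      Nat.le_of_dvd (by norm_num) (hRi ▸ R.card_dvd_index)
    exact (Nat.card_eq_one_iff_unique.mp
      (Nat.ModEq.eq_of_lt_of_lt h1 (by omega) (by omega))).1
  have hRchar : (R : Subgroup (commutator G)).Characteristic := inferInstance
  have hRcyc : IsCyclic R := isCyclic_of_prime_card hR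
  let R' : Subgroup G := (R : Subgroup (commutator G)).map (commutator G).subtype
  have hR'cyc : IsCyclic R' := isCyclic_of_surjective _
    ((commutator G).subtype.subgroupMap_surjective (R : Subgroup (commutator G)))
  have hle := R'.commutator_le_centralizer_of_isCyclic
  have hRn : (R : Subgroup (commutator G)).Normal := inferInstance
  have hnilq : Group.IsNilpotent (commutator G ⧸ (R : Subgroup (commutator G))) :=
    IsPGroup.isNilpotent (p := 2) (IsPGroup.of_card (n := 2) hRi)
  have hnil : Group.IsNilpotent (commutator G) :=
    Subgroup.isNilpotent_of_ker_le_center (QuotientGroup.mk' (R : Subgroup (commutator G))) (by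
      rw [QuotientGroup.ker_mk']
      intro x hx
      rw [Subgroup.mem_center_iff]
      intro y
      exact Subtype.ext (hle y.2 x ⟨x, hx, rfl⟩).symm)
  let V : Sylow 2 (commutator G) := default
  have hV : Nat.card V = 4 := V.card_eq_of_card_eq (k := 2) (m := r) hcard hr2
  have hVn : (V : Subgroup (commutator G)).Normal := inferInstance
  have hVchar : (V : Subgroup (commutator G)).Characteristic := V.characteristic_of_normal hVn
  refine ⟨(V : Subgroup (commutator G)).map (commutator G).subtype, inferInstance, ?_,
    Subgroup.map_subtype_le _⟩
  rw [Subgroup.card_map_of_injective (Subgroup.subtype_injective _)]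
  exact hV

end GroupTheory

/-! ### The binary tetrahedral group as a central extension of `A₄` -/

namespace QuaternionGroup

/-- The automorphism of order three of the quaternion group cyclically permuting `i`, `j`, `k`. -/
def rotate : QuaternionGroup 2 →* QuaternionGroup 2 where
  toFun
    -- The three-cycle is `a 1 ↦ xa 0 ↦ xa 3 ↦ a 1`, with `a 2` fixed.
    | a i => (![a 0, xa 0, a 2, xa 2] : Fin 4 → QuaternionGroup 2) i
    | xa i => (![xa 3, a 3, xa 1, a 1] : Fin 4 → QuaternionGroup 2) i
  map_one' := rfl
  map_mul' := by decide

/-- The action of `ℤ/3` on the quaternion group by rotations. -/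
def rotateHom : Multiplicative (ZMod 3) →* MulAut (QuaternionGroup 2) where
  toFun x := (MonoidHom.toMulEquiv rotate (rotate.comp rotate) (by ext x; revert x; decide)
    (by ext x; revert x; decide) : MulAut (QuaternionGroup 2)) ^ (x.toAdd.val)
  map_one' := rfl
  map_mul' := by
    intro x y
    ext q
    revert x y q
    decide

/-- The permutation representation of the quaternion group on `Fin 4` through the Klein group. -/
def kleinHom : QuaternionGroup 2 →* Equiv.Perm (Fin 4) where
  toFun
    | a i => (![1, c[0, 1] * c[2, 3], 1, c[0, 1] * c[2, 3]] : Fin 4 → Equiv.Perm (Fin 4)) i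
    | xa i => (![c[0, 2] * c[1, 3], c[0, 3] * c[1, 2], c[0, 2] * c[1, 3], c[0, 3] * c[1, 2]] :
        Fin 4 → Equiv.Perm (Fin 4)) i
  map_one' := rfl
  map_mul' := by decide

/-- The three-cycles fixing `0`. -/
def cycleHom : Multiplicative (ZMod 3) →* Equiv.Perm (Fin 4) where
  toFun x := c[1, 2, 3] ^ (x.toAdd.val)
  map_one' := rfl
  map_mul' := by decide

/-- The binary tetrahedral group. -/
abbrev BinaryTetrahedral : Type := QuaternionGroup 2 ⋊[rotateHom] Multiplicative (ZMod 3)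

/-- The projection of the binary tetrahedral group to the alternating group on `Fin 4`. -/
def tetrahedralHom : BinaryTetrahedral →* Equiv.Perm (Fin 4) :=
  SemidirectProduct.lift kleinHom cycleHom (by
    intro x
    ext q : 1
    revert x q
    decide)

theorem tetrahedralHom_mk (q : QuaternionGroup 2) (z : Multiplicative (ZMod 3)) :
    tetrahedralHom ⟨q, z⟩ = kleinHom q * cycleHom z := rfl

theorem exists_tetrahedralHom_eq {σ : Equiv.Perm (Fin 4)} (hσ : Equiv.Perm.sign σ = 1) :
    ∃ e, tetrahedralHom e = σ := by
  have : ∀ σ : Equiv.Perm (Fin 4), Equiv.Perm.sign σ = 1 →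
      ∃ q z, kleinHom q * cycleHom z = σ := by decide
  obtain ⟨q, z, h⟩ := this σ hσ
  exact ⟨⟨q, z⟩, h⟩

/-- The kernel is `{1, a 2}`, and `a 2` is central in the quaternion group and fixed by the
rotations. -/
theorem commute_of_tetrahedralHom_eq_one {e : BinaryTetrahedral} (he : tetrahedralHom e = 1)
    (e' : BinaryTetrahedral) : e * e' = e' * e := by
  have h1 : ∀ q z, kleinHom q * cycleHom z = 1 → z = 1 ∧ (q = a 0 ∨ q = a 2) := by decide
  have h2 : ∀ q : QuaternionGroup 2, a 2 * q = q * a 2 := by decide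
  have h3 : ∀ z, rotateHom z (a 2) = a 2 := by decide
  obtain ⟨q, z⟩ := e
  obtain ⟨q', z'⟩ := e'
  obtain ⟨rfl, rfl | rfl⟩ := h1 q z he
  · exact (one_mul _).trans (mul_one _).symm
  · rw [SemidirectProduct.mul_def, SemidirectProduct.mul_def]
    simp only [map_one, MulAut.one_apply, one_mul, mul_one, h3, h2]

/-- Fixed-point-free even permutations of four points are double transpositions; distinct ones lift
to anticommuting quaternions. This detects `v ⊗ w`. -/
theorem commutator_ne_one_of_tetrahedralHom {e e' : BinaryTetrahedral}
    (he : ∀ i, tetrahedralHom e i ≠ i) (he' : ∀ i, tetrahedralHom e' i ≠ i)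
    (hne : tetrahedralHom e ≠ tetrahedralHom e') : e * e' ≠ e' * e := by
  have h1 : ∀ q z, (∀ i, (kleinHom q * cycleHom z) i ≠ i) → z = 1 ∧ kleinHom q ≠ 1 := by decide
  have h2 : ∀ q q', kleinHom q ≠ 1 → kleinHom q' ≠ 1 → kleinHom q ≠ kleinHom q' →
      q * q' ≠ q' * q := by decide
  obtain ⟨q, z⟩ := e
  obtain ⟨q', z'⟩ := e'
  obtain ⟨rfl, hq⟩ := h1 q z he
  obtain ⟨rfl, hq'⟩ := h1 q' z' he'
  intro h
  rw [SemidirectProduct.mul_def, SemidirectProduct.mul_def] at h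
  have h3 := congrArg SemidirectProduct.left h
  simp only [map_one, MulAut.one_apply] at h3
  refine h2 q q' hq hq' (fun h4 => hne ?_) h3
  rw [tetrahedralHom_mk, tetrahedralHom_mk, h4]

end QuaternionGroup

/-! ### Conjugation on a normal Klein four-subgroup -/

section

open scoped commutatorElement

/-- Data on the conjugation action of a group on a normal Klein four-subgroup `V`: the element `h`
permutes the nontrivial elements `v`, `w`, `u` of `V` cyclically and, together with the centralizer
of `V`, it generates `G`. -/
structure KleinRotation {G : Type*} [Group G] (V : Subgroup G) (h v w u : G) : Prop where
  mem_v : v ∈ V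
  mem_w : w ∈ V
  mem_u : u ∈ V
  conj_v : h * v * h⁻¹ = w
  conj_w : h * w * h⁻¹ = u
  conj_u : h * u * h⁻¹ = v
  ne_vw : v ≠ w
  v_ne : v ≠ 1
  cases : ∀ x ∈ V, x = 1 ∨ x = v ∨ x = w ∨ x = u
  mul_vw : v * w = u
  mul_self : ∀ x ∈ V, x * x = 1
  comm : ∀ x ∈ V, ∀ y ∈ V, x * y = y * x
  decomp : ∀ g, ∃ d, (∀ x ∈ V, d * x = x * d) ∧ (g = d ∨ g = h * d ∨ g = h * (h * d))

/-- `G` modulo the centralizer of `V` is a nontrivial group of odd order acting faithfully on the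
three nontrivial elements, hence cyclic of order three. -/
theorem exists_kleinRotation {G : Type*} [Group G] [Finite G] {V : Subgroup G} [V.Normal]
    (hV : Nat.card V = 4) (hodd : Odd V.index) (hnc : ¬ V ≤ Subgroup.center G) :
    ∃ h v w u, KleinRotation V h v w u := by
  classical
  have hcommV : IsMulCommutative V :=
    IsPGroup.isMulCommutative_of_card_eq_prime_sq (p := 2) (by rw [hV]; rfl)
  have hcomm : ∀ x ∈ V, ∀ y ∈ V, x * y = y * x := fun x hx y hy =>
    congrArg Subtype.val (mul_comm' (⟨x, hx⟩ : V) ⟨y, hy⟩)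
  have hconj : ∀ g, ∀ x ∈ V, g * x * g⁻¹ ∈ V := fun g x hx =>
    Subgroup.Normal.conj_mem inferInstance x hx g
  have hcases : ∀ v ∈ V, ∀ w ∈ V, ∀ u ∈ V, v ≠ 1 → w ≠ 1 → u ≠ 1 → v ≠ w → v ≠ u → w ≠ u →
      ∀ x ∈ V, x = 1 ∨ x = v ∨ x = w ∨ x = u := by
    intro v hv w hw u hu hv1 hw1 hu1 hvw hvu hwu x hx
    by_contra! hx'
    have hinj : Function.Injective
        (![⟨1, one_mem V⟩, ⟨v, hv⟩, ⟨w, hw⟩, ⟨u, hu⟩, ⟨x, hx⟩] : Fin 5 → V) := by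
      intro i j hij
      fin_cases i <;> fin_cases j <;> simp_all [Subtype.ext_iff, eq_comm]
    have := Nat.card_le_card_of_injective _ hinj
    rw [Nat.card_fin, hV] at this
    omega
  let D : Subgroup G := Subgroup.centralizer (V : Set G)
  have hD : ∀ d, d ∈ D ↔ ∀ x ∈ V, d * x = x * d := fun d =>
    ⟨fun hd x hx => (hd x hx).symm, fun hd x hx => (hd x hx).symm⟩
  have hpow : ∀ g, g ^ V.index ∈ D := by
    intro g
    rw [hD]
    exact hcomm _ (V.pow_index_mem g)
  have hsq : ∀ g, g * g ∈ D → g ∈ D := by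
    intro g hg
    obtain ⟨k, hk⟩ := hodd
    have h1 := hpow g
    rw [hk, pow_succ, pow_mul, sq] at h1
    exact (Subgroup.mul_mem_cancel_left D (pow_mem hg k)).mp h1
  -- An element fixing a nontrivial `v` can at most swap the other two, so its square centralizes
  -- `V`; odd index then makes it centralize `V` itself.
  have hfix : ∀ g, ∀ v ∈ V, v ≠ 1 → g * v * g⁻¹ = v → g ∈ D := by
    intro g v hv hv1 hgv
    by_contra hg
    obtain ⟨w, hw, hgw⟩ : ∃ w ∈ V, g * w * g⁻¹ ≠ w := by
      by_contra! hall
      exact hg ((hD g).mpr fun x hx => mul_inv_eq_iff_eq_mul.mp (hall x hx))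
    have hinj : ∀ x y, g * x * g⁻¹ = g * y * g⁻¹ → x = y := fun x y h =>
      mul_left_cancel (mul_right_cancel h)
    have hw1 : w ≠ 1 := by rintro rfl; simp at hgw
    have hwv : v ≠ w := by rintro rfl; exact hgw hgv
    have hgw1 : g * w * g⁻¹ ≠ 1 := by rwa [Ne, conj_eq_one_iff]
    have hgwv : v ≠ g * w * g⁻¹ := fun h => hwv (hinj _ _ (hgv.trans h))
    have hall := hcases v hv w hw _ (hconj g w hw) hv1 hw1 hgw1 hwv hgwv hgw.symm
    have hggw : g * (g * w * g⁻¹) * g⁻¹ = w := by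
      rcases hall _ (hconj g _ (hconj g w hw)) with h | h | h | h
      · rw [conj_eq_one_iff] at h; exact absurd h hgw1
      · exact absurd (hinj _ _ (h.trans hgv.symm)).symm hgwv
      · exact h
      · exact absurd (hinj _ _ h) hgw
    apply hg
    apply hsq
    rw [hD]
    intro x hx
    rcases hall x hx with rfl | rfl | rfl | rfl
    · simp
    · rw [← mul_inv_eq_iff_eq_mul]
      calc g * g * x * (g * g)⁻¹ = g * (g * x * g⁻¹) * g⁻¹ := by group
        _ = x := by rw [hgv, hgv]
    · rw [← mul_inv_eq_iff_eq_mul]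
      calc g * g * x * (g * g)⁻¹ = g * (g * x * g⁻¹) * g⁻¹ := by group
        _ = x := hggw
    · rw [← mul_inv_eq_iff_eq_mul]
      calc g * g * (g * w * g⁻¹) * (g * g)⁻¹ = g * (g * (g * w * g⁻¹) * g⁻¹) * g⁻¹ := by group
        _ = g * w * g⁻¹ := by rw [hggw]
  obtain ⟨v, hv, hvc⟩ := SetLike.not_le_iff_exists.mp hnc
  obtain ⟨h, hh⟩ : ∃ h, h * v ≠ v * h := by
    by_contra! hall
    exact hvc (Subgroup.mem_center_iff.mpr hall)
  have hhD : h ∉ D := fun hd => hh ((hD h).mp hd v hv)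
  have hv1 : v ≠ 1 := by rintro rfl; simp at hh
  have hinj : ∀ x y, h * x * h⁻¹ = h * y * h⁻¹ → x = y := fun x y hxy =>
    mul_left_cancel (mul_right_cancel hxy)
  have hfpf : ∀ x ∈ V, x ≠ 1 → h * x * h⁻¹ ≠ x := fun x hx hx1 hxx => hhD (hfix h x hx hx1 hxx)
  obtain ⟨w, hwdef⟩ : ∃ w, w = h * v * h⁻¹ := ⟨_, rfl⟩
  obtain ⟨u, hudef⟩ : ∃ u, u = h * w * h⁻¹ := ⟨_, rfl⟩
  have hw : w ∈ V := hwdef ▸ hconj h v hv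
  have hu : u ∈ V := hudef ▸ hconj h w hw
  have hw1 : w ≠ 1 := by rwa [hwdef, Ne, conj_eq_one_iff]
  have hu1 : u ≠ 1 := by rwa [hudef, Ne, conj_eq_one_iff]
  have hvw : v ≠ w := fun e => hfpf v hv hv1 (hwdef.symm.trans e.symm)
  have hwu : w ≠ u := fun e => hfpf w hw hw1 (hudef.symm.trans e.symm)
  have hvu : v ≠ u := by
    intro e
    apply hhD
    apply hsq
    apply hfix _ v hv hv1
    calc h * h * v * (h * h)⁻¹ = h * (h * v * h⁻¹) * h⁻¹ := by group
      _ = v := by rw [← hwdef, ← hudef, e]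
  have hall := hcases v hv w hw u hu hv1 hw1 hu1 hvw hvu hwu
  have hcu : h * u * h⁻¹ = v := by
    rcases hall _ (hconj h u hu) with e | e | e | e
    · rw [conj_eq_one_iff] at e; exact absurd e hu1
    · exact e
    · exact absurd (hinj _ _ (e.trans hwdef)).symm hvu
    · exact absurd e (hfpf u hu hu1)
  have hmul : v * w = u := by
    rcases hall _ (mul_mem hv hw) with e | e | e | e
    · have e1 : h * (v * w) * h⁻¹ = w * u := by
        rw [hudef]; conv_rhs => rw [hwdef]
        rw [hwdef]; group
      rw [e, mul_one, mul_inv_cancel] at e1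
      have e2 : w * v = w * u := by rw [← e1, hcomm w hw v hv, e]
      exact absurd (mul_left_cancel e2) hvu
    · exact absurd (mul_eq_left.mp e) hw1
    · exact absurd (mul_eq_right.mp e) hv1
    · exact e
  have hconjmul : ∀ x y, h * (x * y) * h⁻¹ = (h * x * h⁻¹) * (h * y * h⁻¹) := by
    intro x y; group
  have hmul2 : w * u = v := by
    have := hconjmul v w
    rw [hmul, hcu, ← hwdef, ← hudef] at this
    exact this.symm
  have hmul3 : u * v = w := by
    have := hconjmul w u
    rw [hmul2, hcu, ← hwdef, ← hudef] at this
    exact this.symm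
  have huu : u * u = 1 := by
    have : u * u * v = v := by
      calc u * u * v = u * (u * v) := by group
        _ = v := by rw [hmul3, hcomm u hu w hw, hmul2]
    exact mul_eq_right.mp this
  have hvv : v * v = 1 := by
    have := hconjmul u u
    rw [huu, hcu, mul_one, mul_inv_cancel] at this
    exact this.symm
  have hww : w * w = 1 := by
    have := hconjmul v v
    rw [hvv, ← hwdef, mul_one, mul_inv_cancel] at this
    exact this.symm
  refine ⟨h, v, w, u, hv, hw, hu, hwdef.symm, hudef.symm, hcu, hvw, hv1, hall, hmul, ?_, hcomm, ?_⟩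
  · intro x hx
    rcases hall x hx with rfl | rfl | rfl | rfl
    · exact one_mul _
    · exact hvv
    · exact hww
    · exact huu
  -- The image of `v` under `g` selects a power of `h`; dividing it out leaves an element fixing
  -- `v`, which centralizes `V`.
  · intro g
    rcases hall _ (hconj g v hv) with e | e | e | e
    · rw [conj_eq_one_iff] at e; exact absurd e hv1
    · exact ⟨g, (hD g).mp (hfix g v hv hv1 e), Or.inl rfl⟩
    · refine ⟨h⁻¹ * g, (hD _).mp (hfix _ v hv hv1 ?_), Or.inr (Or.inl (by group))⟩
      calc h⁻¹ * g * v * (h⁻¹ * g)⁻¹ = h⁻¹ * (g * v * g⁻¹) * h := by group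
        _ = v := by rw [e, hwdef]; group
    · refine ⟨h⁻¹ * (h⁻¹ * g), (hD _).mp (hfix _ v hv hv1 ?_), Or.inr (Or.inr (by group))⟩
      calc h⁻¹ * (h⁻¹ * g) * v * (h⁻¹ * (h⁻¹ * g))⁻¹
          = h⁻¹ * (h⁻¹ * (g * v * g⁻¹) * h) * h := by
            simp only [mul_inv_rev, inv_inv, mul_assoc]
        _ = v := by rw [e, hudef, hwdef]; group

/-- A nontrivial normal Hall subgroup of order `4` in the commutator subgroup is not central. -/
theorem not_le_center_of_le_commutator {G : Type*} [Group G] [Finite G] {V : Subgroup G} [V.Normal]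
    (hV : Nat.card V = 4) (hodd : Odd V.index) (hle : V ≤ commutator G) :
    ¬ V ≤ Subgroup.center G := by
  intro hc
  obtain ⟨H, hH⟩ := Subgroup.exists_right_complement'_of_coprime (N := V) (by
    rw [hV, show 4 = 2 ^ 2 by norm_num]
    exact (Nat.coprime_two_left.mpr hodd).pow_left 2)
  -- Centrality of `V` makes its complement `H` normal; then `G / H` is abelian, so `V ≤ G' ≤ H`,
  -- which is absurd.
  have hHn : H.Normal := by
    constructor
    intro x hx g
    obtain ⟨⟨v, k⟩, rfl⟩ := hH.2 g
    have hv := Subgroup.mem_center_iff.mp (hc v.2)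
    have : (v : G) * k * x * ((v : G) * k)⁻¹ = k * x * (k : G)⁻¹ := by
      have h1 := hv (k * x * (k : G)⁻¹)
      rw [mul_inv_rev]
      calc (v : G) * k * x * ((k : G)⁻¹ * (v : G)⁻¹) = v * (k * x * (k : G)⁻¹) * (v : G)⁻¹ := by group
        _ = _ := by rw [← h1]; group
    change (v : G) * k * x * ((v : G) * k)⁻¹ ∈ H
    rw [this]
    exact mul_mem (mul_mem k.2 hx) (inv_mem k.2)
  have hcommV : IsMulCommutative V :=
    IsPGroup.isMulCommutative_of_card_eq_prime_sq (p := 2) (by rw [hV]; rfl)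
  have h1 : commutator G ≤ H :=
    Subgroup.Normal.commutator_le_of_self_sup_commutative_eq_top hH.symm.sup_eq_top hcommV
  have h2 : V = ⊥ := by
    rw [← le_bot_iff, ← hH.disjoint.eq_bot]
    exact le_inf le_rfl (hle.trans h1)
  rw [h2, Subgroup.card_bot] at hV
  omega

end

/-! ### Commutators of lifts, and symbols on the Klein group -/

section

open scoped commutatorElement

namespace TensorSquare

section CentralExtension

variable {G E Q : Type*} [Group G] [Group E] [Group Q]

theorem commutatorElement_congr_of_central {π : E →* Q}
    (hπ : ∀ e, π e = 1 → ∀ e', e * e' = e' * e) {a a' b b' : E} (ha : π a = π a')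
    (hb : π b = π b') : ⁅a, b⁆ = ⁅a', b'⁆ := by
  have h1 := hπ (a * a'⁻¹) (by rw [map_mul, map_inv, ha, mul_inv_cancel])
  have h2 := hπ (b * b'⁻¹) (by rw [map_mul, map_inv, hb, mul_inv_cancel])
  obtain ⟨c, rfl⟩ : ∃ c, a = c * a' := ⟨a * a'⁻¹, by group⟩
  obtain ⟨d, rfl⟩ : ∃ d, b = d * b' := ⟨b * b'⁻¹, by group⟩
  simp only [mul_inv_cancel_right] at h1 h2
  calc ⁅c * a', d * b'⁆ = c * (a' * (d * b') * a'⁻¹) * c⁻¹ * (d * b')⁻¹ := by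
        rw [commutatorElement_def]; group
    _ = a' * d * b' * a'⁻¹ * (d * b')⁻¹ := by rw [h1]; group
    _ = d * (a' * b' * a'⁻¹ * b'⁻¹) * d⁻¹ := by rw [← h2 a']; group
    _ = ⁅a', b'⁆ := by rw [h2, commutatorElement_def]; group

/-- A homomorphism to a group with a central extension `π` gives a homomorphism from the tensor
square to the extension: `g ⊗ h` goes to the commutator of lifts of `g` and `h`. -/
def centralLift (π : E →* Q) (hπ : ∀ e, π e = 1 → ∀ e', e * e' = e' * e) (φ : G →* Q) (L : G → E)
    (hL : ∀ g, π (L g) = φ g) : TensorSquare G →* E :=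
  lift (fun g h => ⁅L g, L h⁆)
    (fun g₁ g h => by
      rw [commutatorElement_congr_of_central hπ (a := L (g₁ * g)) (a' := L g₁ * L g) (b := L h)
          (b' := L h) (by simp [hL]) rfl,
        commutatorElement_congr_of_central hπ (a := L (g₁ * g * g₁⁻¹))
          (a' := L g₁ * L g * (L g₁)⁻¹) (b := L (g₁ * h * g₁⁻¹)) (b' := L g₁ * L h * (L g₁)⁻¹)
          (by simp [hL]) (by simp [hL])]
      simp only [commutatorElement_def]
      group)
    (fun g h₁ h => by
      rw [commutatorElement_congr_of_central hπ (a := L g) (a' := L g) (b := L (h₁ * h))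
          (b' := L h₁ * L h) rfl (by simp [hL]),
        commutatorElement_congr_of_central hπ (a := L (h₁ * g * h₁⁻¹))
          (a' := L h₁ * L g * (L h₁)⁻¹) (b := L (h₁ * h * h₁⁻¹)) (b' := L h₁ * L h * (L h₁)⁻¹)
          (by simp [hL]) (by simp [hL])]
      simp only [commutatorElement_def]
      group)

@[simp]
theorem centralLift_tmul (π : E →* Q) (hπ) (φ : G →* Q) (L : G → E) (hL) (g h : G) :
    centralLift π hπ φ L hL (tmul g h) = ⁅L g, L h⁆ := lift_tmul _ _ _ _ _

theorem map_centralLift (π : E →* Q) (hπ) (φ : G →* Q) (L : G → E) (hL) (t : TensorSquare G) :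
    π (centralLift π hπ φ L hL t) = φ (kappa t) := by
  have : π.comp (centralLift π hπ φ L hL) = φ.comp kappa := hom_ext fun g h => by
    simp [hL, map_commutatorElement]
  exact DFunLike.congr_fun this t

end CentralExtension

section Klein

variable {G : Type*} [Group G] {V : Subgroup G} {h v w u : G}

/-- Symbols on `V` lie in the kernel of `kappa`, so `h` fixes them and `v ⊗ w = w ⊗ u = u ⊗ v`. As
`V ≤ G'`, they are alternating. So `v ⊗ u = v ⊗ vw = v ⊗ w` is both equal and inverse to `u ⊗ v`. -/
theorem tmul_eq_one_or_eq_of_kleinRotation (hrot : KleinRotation V h v w u)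
    (hle : V ≤ commutator G) :
    tmul v w * tmul v w = 1 ∧ ∀ a ∈ V, ∀ b ∈ V, tmul a b = 1 ∨ tmul a b = tmul v w := by
  have hker : ∀ a ∈ V, ∀ b ∈ V, kappa (tmul a b) = 1 := fun a ha b hb => by
    rw [kappa_tmul, commutatorElement_eq_one_iff_mul_comm]
    exact hrot.comm a ha b hb
  have hself : ∀ a ∈ V, tmul a a = 1 := fun a ha => by
    obtain ⟨t, rfl⟩ := exists_kappa_eq (hle ha)
    rw [kappa_tmul_kappa, commutatorElement_self]
  have hswap : ∀ a ∈ V, ∀ b, tmul b a = (tmul a b)⁻¹ := fun a ha b => by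
    obtain ⟨t, rfl⟩ := exists_kappa_eq (hle ha)
    exact tmul_kappa_eq_inv t b
  have hwu : tmul w u = tmul v w := by
    have := act_of_kappa_eq_one (hker v hrot.mem_v w hrot.mem_w) h
    rwa [act_tmul, hrot.conj_v, hrot.conj_w] at this
  have huv : tmul u v = tmul v w := by
    have := act_of_kappa_eq_one (hker w hrot.mem_w u hrot.mem_u) h
    rwa [act_tmul, hrot.conj_w, hrot.conj_u, hwu] at this
  have hvu : tmul v u = tmul v w := by
    rw [← hrot.mul_vw, tmul_mul, hself v hrot.mem_v, one_mul,
      act_of_kappa_eq_one (hker v hrot.mem_v w hrot.mem_w)]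
  have hinv : (tmul v w)⁻¹ = tmul v w := by
    rw [← huv, ← hswap u hrot.mem_u, hvu, huv]
  have hwv : tmul w v = tmul v w := by rw [hswap v hrot.mem_v, hinv]
  have huw : tmul u w = tmul v w := by rw [hswap w hrot.mem_w, hwu, hinv]
  refine ⟨by nth_rewrite 1 [← hinv]; exact inv_mul_cancel _, ?_⟩
  intro a ha b hb
  rcases hrot.cases a ha with rfl | rfl | rfl | rfl
  · exact Or.inl (one_tmul b)
  · rcases hrot.cases b hb with rfl | rfl | rfl | rfl
    · exact Or.inl (tmul_one _)
    · exact Or.inl (hself _ ha)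
    · exact Or.inr rfl
    · exact Or.inr hvu
  · rcases hrot.cases b hb with rfl | rfl | rfl | rfl
    · exact Or.inl (tmul_one _)
    · exact Or.inr hwv
    · exact Or.inl (hself _ ha)
    · exact Or.inr hwu
  · rcases hrot.cases b hb with rfl | rfl | rfl | rfl
    · exact Or.inl (tmul_one _)
    · exact Or.inr huv
    · exact Or.inr huw
    · exact Or.inl (hself _ ha)

/-- Bounds the kernel by eight elements. Modulo the central subgroup `W` generated by `v ⊗ w`,
elements centralizing `V` contribute nothing, so only symbols `b ⊗ h` survive, and they multiply as
in `V`. -/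
theorem mem_relKer_of_kleinRotation [V.Normal] (hrot : KleinRotation V h v w u)
    (hle : V ≤ commutator G) (hodd : Odd V.index) {t : TensorSquare G} (ht : t ∈ relKer V) :
    ∃ b ∈ V, t = tmul b h ∨ t = tmul b h * tmul v w := by
  obtain ⟨hz2, hVV⟩ := tmul_eq_one_or_eq_of_kleinRotation hrot hle
  let W := Subgroup.zpowers (tmul v w)
  have hzk : kappa (tmul v w) = 1 := by
    rw [kappa_tmul, commutatorElement_eq_one_iff_mul_comm]
    exact hrot.comm v hrot.mem_v w hrot.mem_w
  have hWk : ∀ ε ∈ W, kappa ε = 1 := by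
    rintro _ ⟨k, rfl⟩
    simp [hzk]
  have hWmem : ∀ a ∈ V, ∀ b ∈ V, tmul a b ∈ W := by
    intro a ha b hb
    rcases hVV a ha b hb with e | e
    · rw [e]; exact one_mem W
    · rw [e]; exact Subgroup.mem_zpowers _
  have hW : ∀ ε ∈ W, ε = 1 ∨ ε = tmul v w := by
    rintro _ ⟨k, rfl⟩
    obtain ⟨j, rfl | rfl⟩ := Int.even_or_odd' k
    · left; simp [zpow_mul, pow_two, hz2]
    · right; simp [zpow_add, zpow_mul, pow_two, hz2]
  have hconj : ∀ a ∈ V, ∀ g, g * a * g⁻¹ ∈ V := fun a ha g =>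
    Subgroup.Normal.conj_mem inferInstance a ha g
  have hact : ∀ a ∈ V, ∀ b ∈ V, ∃ ε ∈ W, act a (tmul b h) = ε * tmul b h := by
    intro a ha b hb
    obtain ⟨t, rfl⟩ := exists_kappa_eq (hle ha)
    refine ⟨tmul (kappa t) (kappa (tmul b h)), hWmem _ ha _ ?_, ?_⟩
    · rw [kappa_tmul, commutatorElement_def, mul_assoc, mul_assoc, ← mul_assoc h]
      exact mul_mem hb (hconj _ (inv_mem hb) h)
    · rw [kappa_tmul_kappa, act_kappa, commutatorElement_def]; group
  -- The square of `a ⊗ d` is `1`, so it equals its odd power `a ⊗ d ^ V.index`, whose entries both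
  -- lie in `V`.
  have hcen : ∀ d, (∀ x ∈ V, d * x = x * d) → ∀ a ∈ V, tmul a d ∈ W := by
    intro d hd a ha
    have hk : kappa (tmul a d) = 1 := by
      rw [kappa_tmul, commutatorElement_eq_one_iff_mul_comm, hd a ha]
    have h2 : tmul a d * tmul a d = 1 := by
      have := mul_tmul a a d
      rwa [hrot.mul_self a ha, one_tmul, act_of_kappa_eq_one hk, eq_comm] at this
    have hpow : ∀ k : ℕ, tmul a (d ^ k) = tmul a d ^ k := by
      intro k
      induction k with
      | zero => simp
      | succ k ih => rw [pow_succ, tmul_mul, act_of_kappa_eq_one hk, ih, pow_succ]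
    have h3 := hpow V.index
    obtain ⟨k, hk'⟩ := hodd
    have h4 : tmul a d ^ V.index = tmul a d := by
      rw [hk', pow_succ, pow_mul, sq, h2, one_pow, one_mul]
    rw [← h4, ← h3]
    exact hWmem a ha _ (V.pow_index_mem d)
  let S : Subgroup (TensorSquare G) :=
    { carrier := {x | ∃ b ∈ V, ∃ ε ∈ W, x = tmul b h * ε}
      one_mem' := ⟨1, one_mem V, 1, one_mem W, by simp⟩
      mul_mem' := by
        rintro _ _ ⟨b, hb, ε, hε, rfl⟩ ⟨b', hb', ε', hε', rfl⟩
        obtain ⟨δ, hδ, e⟩ := hact b' hb' b hb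
        have e1 := mul_tmul b' b h
        rw [e] at e1
        refine ⟨b' * b, mul_mem hb' hb, δ⁻¹ * (ε * ε'),
          mul_mem (inv_mem hδ) (mul_mem hε hε'), ?_⟩
        have c1 := comm_of_kappa_eq_one (hWk δ hδ)
        have c2 := comm_of_kappa_eq_one (hWk ε hε)
        calc tmul b h * ε * (tmul b' h * ε') = tmul b h * (ε * tmul b' h) * ε' := by group
          _ = tmul b h * tmul b' h * (ε * ε') := by rw [c2]; group
          _ = δ * (δ⁻¹ * (tmul b h * tmul b' h * (ε * ε'))) := by group
          _ = δ * tmul b h * tmul b' h * (δ⁻¹ * (ε * ε')) := by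
              have c3 := comm_of_kappa_eq_one (t := δ⁻¹) (by rw [map_inv, hWk δ hδ, inv_one])
              rw [← mul_assoc δ⁻¹, c3]; group
          _ = tmul (b' * b) h * (δ⁻¹ * (ε * ε')) := by rw [e1]
      inv_mem' := by
        rintro _ ⟨b, hb, ε, hε, rfl⟩
        obtain ⟨δ, hδ, e⟩ := hact b hb b⁻¹ (inv_mem hb)
        rw [act_inv_tmul] at e
        refine ⟨b⁻¹, inv_mem hb, δ * ε⁻¹, mul_mem hδ (inv_mem hε), ?_⟩
        have c1 := comm_of_kappa_eq_one (hWk δ hδ)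
        have c3 := comm_of_kappa_eq_one (t := ε⁻¹) (by rw [map_inv, hWk ε hε, inv_one])
        rw [mul_inv_rev, e, c3, c1, mul_assoc] }
  have hleft : ∀ a ∈ V, ∀ g, tmul a g ∈ S := by
    intro a ha g
    obtain ⟨d, hd, rfl | rfl | rfl⟩ := hrot.decomp g
    · exact ⟨1, one_mem V, _, hcen g hd a ha, by simp⟩
    · refine ⟨a, ha, tmul a d, hcen d hd a ha, ?_⟩
      rw [tmul_mul, act_of_kappa_eq_one (hWk _ (hcen d hd a ha))]
    · have h1 : ∀ b ∈ V, tmul b h ∈ S := fun b hb => ⟨b, hb, 1, one_mem W, by simp⟩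
      have h2 : tmul a d ∈ S := ⟨1, one_mem V, _, hcen d hd a ha, by simp⟩
      rw [tmul_mul, tmul_mul, act_of_kappa_eq_one (hWk _ (hcen d hd a ha)), map_mul,
        act_of_kappa_eq_one (hWk _ (hcen d hd a ha)), act_tmul, mul_inv_cancel_right]
      exact mul_mem (h1 a ha) (mul_mem (h1 _ (hconj a ha h)) h2)
  have hS : relKer V ≤ S := by
    rw [relKer, Subgroup.closure_le]
    rintro _ ⟨a, ha, g, rfl | rfl⟩
    · exact hleft a ha g
    · obtain ⟨t, rfl⟩ := exists_kappa_eq (hle ha)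
      rw [tmul_kappa_eq_inv]
      exact inv_mem (hleft _ ha g)
  obtain ⟨b, hb, ε, hε, rfl⟩ := hS ht
  refine ⟨b, hb, ?_⟩
  rcases hW ε hε with rfl | rfl
  · exact Or.inl (mul_one _)
  · exact Or.inr rfl

end Klein

end TensorSquare

end

/-! ### Splitting off the quaternion group -/

section

open scoped commutatorElement

namespace TensorSquare

variable {G : Type*} [Group G] {V : Subgroup G} {h v w u : G}

/-- The action of `G` on the cosets of a complement of a normal subgroup of order `4`: on that
subgroup it is free, and it is by even permutations if `G` has no quotient of order two. -/
theorem exists_hom_perm_four [Finite G] [V.Normal] (hV : Nat.card V = 4) (hodd : Odd V.index)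
    (hab : Odd (commutator G).index) :
    ∃ φ : G →* Equiv.Perm (Fin 4), (∀ g, Equiv.Perm.sign (φ g) = 1) ∧
      ∀ x ∈ V, x ≠ 1 → ∀ i, φ x i ≠ i := by
  obtain ⟨H, hH⟩ := Subgroup.exists_right_complement'_of_coprime (N := V) (by
    rw [hV, show 4 = 2 ^ 2 by norm_num]
    exact (Nat.coprime_two_left.mpr hodd).pow_left 2)
  have hc : Nat.card (G ⧸ H) = 4 := hH.index_eq_card.trans hV
  let e : (G ⧸ H) ≃ Fin 4 := Finite.equivFinOfCardEq hc
  let φ : G →* Equiv.Perm (Fin 4) :=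
    e.permCongrHom.toMonoidHom.comp (MulAction.toPermHom G (G ⧸ H))
  refine ⟨φ, fun g => ?_, fun x hx hx1 i hi => hx1 ?_⟩
  · let s : G →* ℤˣ := Equiv.Perm.sign.comp φ
    obtain ⟨k, hk⟩ := hab
    have h1 : s (g ^ (commutator G).index) = 1 :=
      Abelianization.commutator_subset_ker s ((commutator G).pow_index_mem g)
    rw [map_pow, hk, pow_succ, pow_mul, Int.units_sq, one_pow, one_mul] at h1
    exact h1
  -- A fixed coset puts a conjugate of `x` in both `V` and its complement.
  · obtain ⟨q, rfl⟩ := e.surjective i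
    have h1 : x • q = q := by
      apply e.injective
      have : φ x (e q) = e (x • q) := by simp [φ, Equiv.permCongrHom]
      rw [← this, hi]
    obtain ⟨g, rfl⟩ := QuotientGroup.mk_surjective q
    have h2 : g⁻¹ * (x * g) ∈ H := by
      rw [← QuotientGroup.eq]
      exact h1.symm
    have h3 : g⁻¹ * (x * g) ∈ V := by
      have := Subgroup.Normal.conj_mem inferInstance x hx g⁻¹
      rwa [inv_inv, mul_assoc] at this
    have h4 : g⁻¹ * (x * g) = 1 := by
      rw [← Subgroup.mem_bot, ← hH.disjoint.eq_bot]
      exact ⟨h3, h2⟩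
    have h5 : x = g * (g⁻¹ * (x * g)) * g⁻¹ := by group
    rw [h5, h4]; group

/-- The quaternion group as a quotient of the tensor square. -/
theorem exists_hom_quaternionGroup [Finite G] [V.Normal] (hV : Nat.card V = 4)
    (hodd : Odd V.index) (hab : Odd (commutator G).index) (hrot : KleinRotation V h v w u) :
    ∃ F : TensorSquare G →* QuaternionGroup 2, F (tmul v w) ≠ 1 ∧
      ∀ t, F t = 1 → kappa t ∈ V → kappa t = 1 := by
  obtain ⟨φ, hsign, hfree⟩ := exists_hom_perm_four hV hodd hab
  choose L hL using fun g => QuaternionGroup.exists_tetrahedralHom_eq (hsign g)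
  let F₀ := centralLift QuaternionGroup.tetrahedralHom
    (fun e he e' => QuaternionGroup.commute_of_tetrahedralHom_eq_one he e') φ L hL
  -- The `ℤ/3` factor is abelian, so commutators of lifts lie in the quaternion group.
  have hright : ∀ t, (F₀ t).right = 1 := by
    intro t
    have : SemidirectProduct.rightHom.comp F₀ = 1 := hom_ext fun a b => by
      rw [MonoidHom.comp_apply, centralLift_tmul, map_commutatorElement, MonoidHom.one_apply,
        commutatorElement_eq_one_iff_mul_comm, mul_comm]
    exact DFunLike.congr_fun this t
  let F : TensorSquare G →* QuaternionGroup 2 :=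
    { toFun := fun t => (F₀ t).left
      map_one' := by rw [map_one]; rfl
      map_mul' := fun s t => by
        rw [map_mul, SemidirectProduct.mul_left, hright s, map_one, MulAut.one_apply] }
  have hF : ∀ t, F t = 1 → F₀ t = 1 := fun t ht => SemidirectProduct.ext ht (hright t)
  refine ⟨F, fun h1 => ?_, fun t ht hk => ?_⟩
  · have h2 := hF _ h1
    rw [centralLift_tmul, commutatorElement_eq_one_iff_mul_comm] at h2
    have hw1 : w ≠ 1 := by
      rw [← hrot.conj_v, Ne, conj_eq_one_iff]
      exact hrot.v_ne
    refine QuaternionGroup.commutator_ne_one_of_tetrahedralHom ?_ ?_ ?_ h2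
    · rw [hL]; exact hfree v hrot.mem_v hrot.v_ne
    · rw [hL]; exact hfree w hrot.mem_w hw1
    · rw [hL, hL]
      intro h3
      have h4 : φ (v * w⁻¹) = 1 := by rw [map_mul, map_inv, h3, mul_inv_cancel]
      refine hfree (v * w⁻¹) (mul_mem hrot.mem_v (inv_mem hrot.mem_w)) ?_ 0 (by rw [h4]; rfl)
      rw [Ne, mul_inv_eq_one]
      exact hrot.ne_vw
  · by_contra hne
    have h1 := map_centralLift QuaternionGroup.tetrahedralHom
      (fun e he e' => QuaternionGroup.commute_of_tetrahedralHom_eq_one he e') φ L hL t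
    rw [show centralLift _ _ φ L hL t = 1 from hF t ht, map_one] at h1
    exact hfree _ hk hne 0 (by rw [← h1]; rfl)

/-- The tensor square of a group with a normal Hall Klein four-subgroup `V ≤ G'` and without
quotients of order two. -/
theorem nonempty_equiv_prod_quaternionGroup [Finite G] [V.Normal] (hV : Nat.card V = 4)
    (hodd : Odd V.index) (hab : Odd (commutator G).index) (hle : V ≤ commutator G) :
    Nonempty (TensorSquare G ≃* TensorSquare (G ⧸ V) × QuaternionGroup 2) := by
  obtain ⟨h, v, w, u, hrot⟩ := exists_kleinRotation hV hodd
    (not_le_center_of_le_commutator hV hodd hle)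
  obtain ⟨F, hFz, hFk⟩ := exists_hom_quaternionGroup hV hodd hab hrot
  have hz1 : tmul v w ≠ 1 := fun e => hFz (by rw [e, map_one])
  have hzk : kappa (tmul v w) = 1 := by
    rw [kappa_tmul, commutatorElement_eq_one_iff_mul_comm]
    exact hrot.comm v hrot.mem_v w hrot.mem_w
  have hkV : ∀ b ∈ V, kappa (tmul b h) ∈ V := by
    intro b hb
    rw [kappa_tmul, commutatorElement_def, mul_assoc, mul_assoc, ← mul_assoc h]
    exact mul_mem hb (Subgroup.Normal.conj_mem inferInstance _ (inv_mem hb) h)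
  have hfix : ∀ b ∈ V, b * h = h * b → b = 1 := by
    intro b hb e
    have e1 : h * b * h⁻¹ = b := by rw [← e, mul_inv_cancel_right]
    have hvw := hrot.ne_vw
    rcases hrot.cases b hb with rfl | rfl | rfl | rfl
    · rfl
    · exact absurd (e1.symm.trans hrot.conj_v) hvw
    · rw [hrot.conj_w] at e1
      have := hrot.mul_vw
      rw [e1, mul_eq_right] at this
      exact absurd this hrot.v_ne
    · rw [hrot.conj_u] at e1
      have := hrot.mul_vw
      rw [← e1, mul_eq_left] at this
      have h2 := hrot.conj_v
      rw [this, conj_eq_one_iff] at h2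
      exact absurd h2 hrot.v_ne
  -- If `F` kills `(b ⊗ h) * z`, with `z` equal to `1` or `v ⊗ w`, then `kappa (b ⊗ h) = 1`, so `b`
  -- commutes with `h` and is `1`; and `F (v ⊗ w) ≠ 1` leaves only `z = 1`.
  have hinjK : ∀ t ∈ relKer V, F t = 1 → t = 1 := by
    intro t ht hFt
    obtain ⟨b, hb, e⟩ := mem_relKer_of_kleinRotation hrot hle hodd ht
    have hk : kappa t = kappa (tmul b h) := by
      rcases e with rfl | rfl
      · rfl
      · rw [map_mul, hzk, mul_one]
    have hk1 := hFk t hFt (hk ▸ hkV b hb)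
    rw [hk, kappa_tmul, commutatorElement_eq_one_iff_mul_comm] at hk1
    obtain rfl := hfix b hb hk1
    rw [one_tmul, one_mul] at e
    rcases e with rfl | rfl
    · rfl
    · exact absurd hFt hFz
  let f : V × Fin 2 → QuaternionGroup 2 := fun x => F (tmul (x.1 : G) h * ![1, tmul v w] x.2)
  have hmem : ∀ x : V × Fin 2, tmul (x.1 : G) h * ![1, tmul v w] x.2 ∈ relKer V := by
    rintro ⟨x, i⟩
    refine mul_mem (tmul_mem_relKer_left x.2 h) ?_
    fin_cases i
    · exact one_mem _
    · exact tmul_mem_relKer_left hrot.mem_v w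
  have hFinj : ∀ s ∈ relKer V, ∀ t ∈ relKer V, F s = F t → s = t := by
    intro s hs t ht e
    rw [← mul_inv_eq_one]
    exact hinjK _ (mul_mem hs (inv_mem ht)) (by rw [map_mul, map_inv, e, mul_inv_cancel])
  have hfinj : Function.Injective f := by
    rintro ⟨x, i⟩ ⟨y, j⟩ e
    have e1 := hFinj _ (hmem (x, i)) _ (hmem (y, j)) e
    have hk : ∀ i : Fin 2, kappa ((![1, tmul v w] : Fin 2 → TensorSquare G) i) = 1 := by
      intro i
      fin_cases i
      · exact map_one _
      · exact hzk
    have e2 := congrArg kappa e1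
    simp only [map_mul, hk, mul_one, kappa_tmul, commutatorElement_def] at e2
    have e3 : (y : G)⁻¹ * x = 1 := by
      refine hfix _ (mul_mem (inv_mem y.2) x.2) ?_
      have e4 : (x : G) * h * (x : G)⁻¹ = y * h * (y : G)⁻¹ := mul_right_cancel e2
      calc (y : G)⁻¹ * x * h = (y : G)⁻¹ * (x * h * (x : G)⁻¹) * x := by group
        _ = h * ((y : G)⁻¹ * x) := by rw [e4]; group
    have e5 : x = y := Subtype.ext (inv_mul_eq_one.mp e3).symm
    subst e5
    have e6 := mul_left_cancel e1
    have e7 : i = j := by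
      fin_cases i <;> fin_cases j
      · rfl
      · exact absurd e6.symm hz1
      · exact absurd e6 hz1
      · rfl
    rw [e7]
  -- The `4 · 2` listed kernel elements have distinct images in a group of order eight. So any value
  -- of `F` can be corrected without changing the image in the tensor square of `G ⧸ V`.
  have hfsurj : Function.Surjective f := by
    have hcard : Nat.card (V × Fin 2) = Nat.card (QuaternionGroup 2) := by
      rw [Nat.card_prod, hV, Nat.card_fin, Nat.card_eq_fintype_card, QuaternionGroup.card]
    exact ((Nat.bijective_iff_injective_and_card f).mpr ⟨hfinj, hcard⟩).2
  let Φ := (map (QuotientGroup.mk' V)).prod F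
  refine ⟨MulEquiv.ofBijective Φ ⟨?_, ?_⟩⟩
  · rw [injective_iff_map_eq_one]
    intro t ht
    refine hinjK t ?_ (congrArg Prod.snd ht)
    rw [← ker_map_mk']
    exact congrArg Prod.fst ht
  · rintro ⟨a, y⟩
    obtain ⟨t, rfl⟩ := map_surjective (QuotientGroup.mk'_surjective V) a
    obtain ⟨x, hx⟩ := hfsurj ((F t)⁻¹ * y)
    have h1 : map (QuotientGroup.mk' V) (tmul (x.1 : G) h * ![1, tmul v w] x.2) = 1 := by
      have := hmem x
      rwa [← ker_map_mk', MonoidHom.mem_ker] at this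
    refine ⟨t * (tmul (x.1 : G) h * ![1, tmul v w] x.2), Prod.ext ?_ ?_⟩
    · change map (QuotientGroup.mk' V) (t * (tmul (x.1 : G) h * ![1, tmul v w] x.2)) = _
      rw [map_mul, h1, mul_one]
    · change F (t * (tmul (x.1 : G) h * ![1, tmul v w] x.2)) = y
      rw [map_mul, show F (tmul (x.1 : G) h * ![1, tmul v w] x.2) = (F t)⁻¹ * y from hx,
        mul_inv_cancel_left]

end TensorSquare

end

/-! ### Assembly of the isomorphisms and the main theorem -/

namespace TensorSquare

/-- The Chinese remainder theorem for the multiplicative copies of `ℤ/a` and `ℤ/b`. -/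
def _root_.ZMod.multiplicativeProdEquiv {a b : ℕ} (h : a.Coprime b) :
    Multiplicative (ZMod a) × Multiplicative (ZMod b) ≃* Multiplicative (ZMod (a * b)) :=
  (MulEquiv.prodMultiplicative _ _).symm.trans
    (AddEquiv.toMultiplicative (ZMod.chineseRemainder h).toAddEquiv.symm)

variable {G : Type*} [Group G] [Finite G]

theorem nonempty_equiv_zmod_index_prod [IsCyclic (commutator G)] [IsCyclic (Abelianization G)]
    (hco : (Nat.card (commutator G)).Coprime (commutator G).index) :
    Nonempty (TensorSquare G ≃* Multiplicative (ZMod (commutator G).index) × commutator G) := by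
  obtain ⟨e⟩ := nonempty_equiv_prod_of_coprime hco
  obtain ⟨f⟩ := nonempty_equiv_of_isCyclic (B := Abelianization G)
  exact ⟨e.trans (f.prodCongr (MulEquiv.refl _))⟩

theorem nonempty_equiv_zmod_card [IsCyclic (commutator G)] [IsCyclic (Abelianization G)]
    (hco : (Nat.card (commutator G)).Coprime (commutator G).index) :
    Nonempty (TensorSquare G ≃* Multiplicative (ZMod (Nat.card G))) := by
  obtain ⟨e⟩ := nonempty_equiv_zmod_index_prod hco
  have f := (zmodCyclicMulEquiv (inferInstance : IsCyclic (commutator G))).symm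
  have e2 := e.trans (((MulEquiv.refl _).prodCongr f).trans
    (ZMod.multiplicativeProdEquiv hco.symm))
  rw [Subgroup.index_mul_card] at e2
  exact ⟨e2⟩

/-- A group of squarefree order is a Z-group, and its tensor square is cyclic of the same order. -/
theorem nonempty_equiv_of_squarefree_card (h : Squarefree (Nat.card G)) :
    Nonempty (TensorSquare G ≃* Multiplicative (ZMod (Nat.card G))) := by
  have : IsZGroup G := IsZGroup.of_squarefree h
  have : IsCyclic (commutator G) := IsZGroup.isCyclic_commutator G
  have : IsCyclic (Abelianization G) := IsZGroup.isCyclic_abelianization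
  exact nonempty_equiv_zmod_card (IsZGroup.coprime_commutator_index G)

theorem nonempty_equiv_of_not_isCyclic_abelianization [IsCyclic (commutator G)] {p m : ℕ}
    (hp : p.Prime) (hm : Squarefree m) (hpm : p.Coprime m)
    (hco : (Nat.card (commutator G)).Coprime (commutator G).index)
    (hind : (commutator G).index = p ^ 2 * m) (hab : ¬ IsCyclic (Abelianization G)) :
    Nonempty (TensorSquare G ≃*
      (Multiplicative (Fin 4 → ZMod p) × Multiplicative (ZMod m)) × commutator G) := by
  obtain ⟨e⟩ := nonempty_equiv_prod_of_coprime hco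
  obtain ⟨f⟩ := nonempty_equiv_of_not_isCyclic (B := Abelianization G) hp hm hpm hind hab
  exact ⟨e.trans (f.prodCongr (MulEquiv.refl _))⟩

theorem nonempty_equiv_zmod_three_mul_prod_quaternionGroup {r : ℕ} (hr : r.Prime) (hr5 : 5 ≤ r)
    (hcard : Nat.card G = 12 * r)
    (hcomm : Nat.card (commutator G) = 4 ∨ Nat.card (commutator G) = 4 * r) :
    Nonempty (TensorSquare G ≃* Multiplicative (ZMod (3 * r)) × QuaternionGroup 2) := by
  obtain ⟨V, hVn, hV, hVle⟩ := exists_normal_card_eq_four hr hr5 hcomm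
  have hrodd : Odd r := hr.odd_of_ne_two (by omega)
  have h3r : Odd (3 * r) := Odd.mul (by decide) hrodd
  have hVi : V.index = 3 * r := by
    have := V.card_mul_index
    rw [hV, hcard] at this
    omega
  have hci := (commutator G).card_mul_index
  have hab : Odd (commutator G).index := by
    rcases hcomm with h | h
    · rw [h, hcard] at hci
      rw [show (commutator G).index = 3 * r by omega]
      exact h3r
    · rw [h, hcard, show 12 * r = 4 * r * 3 by ring] at hci
      rw [Nat.eq_of_mul_eq_mul_left (by omega) hci]
      decide
  obtain ⟨e⟩ := nonempty_equiv_prod_quaternionGroup hV (hVi ▸ h3r) hab hVle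
  have hq : Nat.card (G ⧸ V) = 3 * r := hVi
  have hsq : Squarefree (3 * r) := (Nat.squarefree_mul
    ((Nat.coprime_primes Nat.prime_three hr).mpr (by omega))).mpr
      ⟨Nat.prime_three.prime.squarefree, hr.prime.squarefree⟩
  obtain ⟨f⟩ := nonempty_equiv_of_squarefree_card (G := G ⧸ V) (hq ▸ hsq)
  rw [hq] at f
  exact ⟨e.trans (f.prodCongr (MulEquiv.refl _))⟩

end TensorSquare

/-- A prime divisor of `qr` exceeds `p`; if it divides `p + 1` it equals `p + 1`, so `p` and `q` are
consecutive integers, namely 2 and 3. Otherwise transfer applies to a Sylow `p`-subgroup. -/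
theorem card_commutator_dvd_of_mul_ne_six {G : Type*} [Group G] [Finite G] {p q r : ℕ}
    (hp : p.Prime) (hq : q.Prime) (hr : r.Prime) (hpq : p < q) (hqr : q < r)
    (hcard : Nat.card G = p ^ 2 * (q * r)) (h6 : p * q ≠ 6) :
    Nat.card (commutator G) ∣ q * r := by
  have : Fact p.Prime := ⟨hp⟩
  have hdvd : ∀ ℓ, ℓ.Prime → ℓ ∣ q * r → ℓ = q ∨ ℓ = r := fun ℓ hℓ h =>
    (hℓ.dvd_mul.mp h).imp (fun h => (Nat.prime_dvd_prime_iff_eq hℓ hq).mp h)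
      (fun h => (Nat.prime_dvd_prime_iff_eq hℓ hr).mp h)
  have hm : ∀ ℓ, ℓ.Prime → ℓ ∣ q * r → p < ℓ ∧ ¬ ℓ ∣ p + 1 := by
    intro ℓ hℓ h
    refine ⟨by rcases hdvd ℓ hℓ h with rfl | rfl <;> omega, fun h1 => h6 ?_⟩
    have h2 := Nat.le_of_dvd (by omega) h1
    obtain rfl : ℓ = q := by rcases hdvd ℓ hℓ h with rfl | rfl <;> omega
    obtain rfl : ℓ = p + 1 := by omega
    rcases hp.eq_two_or_odd with rfl | hodd
    · rfl
    · rcases hq.eq_two_or_odd with h3 | h3 <;> have := hp.two_le <;> omega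
  have hpm : ¬ p ∣ q * r := fun h => (hm p hp h).1.false
  let P : Sylow p G := default
  have hP : Nat.card P = p ^ 2 := P.card_eq_of_card_eq hcard hpm
  have hi : P.index = q * r := by
    have := (P : Subgroup G).card_mul_index
    change Nat.card P * _ = _ at this
    rw [hP, hcard] at this
    exact Nat.eq_of_mul_eq_mul_left (pow_pos hp.pos 2) this
  rw [← hi]
  exact P.card_commutator_dvd_index (P.normalizer_le_centralizer_of_card hcard hm hP)

theorem theoremD {G : Type*} [Group G] (p q r : ℕ)
    (hp : p.Prime) (hq : q.Prime) (hr : r.Prime) (hpq : p < q) (hqr : q < r)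
    (hcard : Nat.card G = p ^ 2 * q * r)
    (hnonab : ¬ ∀ a b : G, a * b = b * a) :
    -- if `pq ≠ 6`, the cases treated in the next two parts are the only ones
    (p * q ≠ 6 →
      Nat.card (commutator G) = q ∨ Nat.card (commutator G) = r ∨
        Nat.card (commutator G) = q * r) ∧
    -- part (i), valid for all `p < q < r`
    ((Nat.card (commutator G) = q ∨ Nat.card (commutator G) = r ∨
        (Nat.card (commutator G) = q * r ∧ ¬ q ∣ r - 1)) →
      (IsCyclic (Abelianization G) →
        Nonempty (TensorSquare G ≃* Multiplicative (ZMod (p ^ 2 * q * r)))) ∧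
      (¬ IsCyclic (Abelianization G) →
        Nonempty (TensorSquare G ≃*
          Multiplicative (Fin 4 → ZMod p) × Multiplicative (ZMod (q * r))))) ∧
    -- part (ii), valid for all `p < q < r`
    ((Nat.card (commutator G) = q * r ∧ q ∣ r - 1) →
      (IsCyclic (Abelianization G) →
        Nonempty (TensorSquare G ≃* Multiplicative (ZMod (p ^ 2)) × commutator G)) ∧
      (¬ IsCyclic (Abelianization G) →
        Nonempty (TensorSquare G ≃* Multiplicative (Fin 4 → ZMod p) × commutator G))) ∧
    -- the remaining cases for `pq = 6`, that is `|G| = 12r`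
    (p * q = 6 →
      (commutator G ≠ ⊤ →
        Nat.card (commutator G) = 3 ∨ Nat.card (commutator G) = r ∨
          Nat.card (commutator G) = 3 * r ∨ Nat.card (commutator G) = 4 ∨
          Nat.card (commutator G) = 4 * r) ∧
      ((Nat.card (commutator G) = 4 ∨ Nat.card (commutator G) = 4 * r) →
        Nonempty (TensorSquare G ≃* Multiplicative (ZMod (3 * r)) × QuaternionGroup 2))) := by
  have : Finite G := Nat.finite_of_card_ne_zero (by
    rw [hcard]
    exact mul_ne_zero (mul_ne_zero (pow_ne_zero _ hp.ne_zero) hq.ne_zero) hr.ne_zero)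
  have hbot : commutator G ≠ ⊥ := by
    intro h
    apply hnonab
    intro a b
    have := Subgroup.commutator_mem_commutator (Subgroup.mem_top a) (Subgroup.mem_top b)
    rw [← commutator_def, h, Subgroup.mem_bot] at this
    exact commutatorElement_eq_one_iff_mul_comm.mp this
  have hcard' : Nat.card G = p ^ 2 * (q * r) := by rw [hcard, mul_assoc]
  have hsq : Squarefree (q * r) := (Nat.squarefree_mul
    ((Nat.coprime_primes hq hr).mpr hqr.ne)).mpr ⟨hq.prime.squarefree, hr.prime.squarefree⟩
  have hpqr : p.Coprime (q * r) := Nat.Coprime.mul_right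
    ((Nat.coprime_primes hp hq).mpr hpq.ne) ((Nat.coprime_primes hp hr).mpr (hpq.trans hqr).ne)
  -- Uniform setup for parts (i) and (ii): `n` is the order of `G'` and `m` the complementary factor
  -- of `qr`, so the index is `p ^ 2 * m`.
  have hindex : ∀ n m, n * m = q * r → Nat.card (commutator G) = n →
      IsCyclic (commutator G) ∧ (commutator G).index = p ^ 2 * m ∧
        (Nat.card (commutator G)).Coprime (commutator G).index ∧ n.Coprime m ∧
        Squarefree m ∧ p.Coprime m := by
    intro n m hnm hn
    have hn0 : 0 < n := hn ▸ Nat.card_pos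
    have hsq' : Squarefree (n * m) := hnm ▸ hsq
    have hnmc : n.Coprime m := Nat.coprime_of_squarefree_mul hsq'
    have hi : (commutator G).index = p ^ 2 * m := by
      have := (commutator G).card_mul_index
      rw [hn, hcard', ← hnm, mul_left_comm] at this
      exact Nat.eq_of_mul_eq_mul_left hn0 this
    have hz : IsZGroup (commutator G) :=
      IsZGroup.of_squarefree (hn ▸ hsq'.squarefree_of_dvd (dvd_mul_right n m))
    refine ⟨isCyclic_commutator_of_isZGroup, hi, ?_, hnmc,
      hsq'.squarefree_of_dvd (dvd_mul_left m n),
      hpqr.coprime_dvd_right (hnm ▸ dvd_mul_left m n)⟩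
    rw [hi, hn]
    exact Nat.Coprime.mul_right
      ((hpqr.coprime_dvd_right (hnm ▸ dvd_mul_right n m)).symm.pow_right 2) hnmc
  refine ⟨fun h6 => ?_, fun h => ?_, fun ⟨h, _⟩ => ?_, fun h6 => ?_⟩
  · obtain ⟨a, b, ha, hb, hab⟩ := Nat.dvd_mul.mp
      (card_commutator_dvd_of_mul_ne_six hp hq hr hpq hqr hcard' h6)
    have h1 : Nat.card (commutator G) ≠ 1 := fun h => hbot (Subgroup.card_eq_one.mp h)
    rw [← hab] at h1 ⊢
    rcases (Nat.dvd_prime hq).mp ha with rfl | rfl <;>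
      rcases (Nat.dvd_prime hr).mp hb with rfl | rfl
    · exact absurd (mul_one 1) h1
    · exact Or.inr (Or.inl (one_mul _))
    · exact Or.inl (mul_one _)
    · exact Or.inr (Or.inr rfl)
  · obtain ⟨n, m, hnm, hn⟩ : ∃ n m, n * m = q * r ∧ Nat.card (commutator G) = n := by
      rcases h with h | h | ⟨h, _⟩
      · exact ⟨q, r, rfl, h⟩
      · exact ⟨r, q, mul_comm r q, h⟩
      · exact ⟨q * r, 1, mul_one _, h⟩
    obtain ⟨hcyc, hi, hco, hnmc, hm, hpm⟩ := hindex n m hnm hn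
    refine ⟨fun hab => hcard ▸ TensorSquare.nonempty_equiv_zmod_card hco, fun hab => ?_⟩
    obtain ⟨e⟩ := TensorSquare.nonempty_equiv_of_not_isCyclic_abelianization hp hm hpm hco hi hab
    have f := (zmodCyclicMulEquiv hcyc).symm
    rw [hn] at f
    have e2 := ((MulEquiv.refl (Multiplicative (ZMod m))).prodCongr f).trans
      (ZMod.multiplicativeProdEquiv hnmc.symm)
    rw [mul_comm m n, hnm] at e2
    exact ⟨(e.trans MulEquiv.prodAssoc).trans ((MulEquiv.refl _).prodCongr e2)⟩
  · obtain ⟨hcyc, hi, hco, hnmc, hm, hpm⟩ := hindex (q * r) 1 (mul_one _) h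
    refine ⟨fun hab => ?_, fun hab => ?_⟩
    · rw [mul_one] at hi
      exact hi ▸ TensorSquare.nonempty_equiv_zmod_index_prod hco
    · obtain ⟨e⟩ := TensorSquare.nonempty_equiv_of_not_isCyclic_abelianization hp hm hpm hco hi hab
      -- Here `m = 1`, so the factor `ZMod 1` is trivial and disappears.
      exact ⟨e.trans (MulEquiv.prodUnique.prodCongr (MulEquiv.refl _))⟩
  · obtain ⟨rfl, rfl⟩ : p = 2 ∧ q = 3 := by
      have := hp.two_le
      have : p ≤ 6 := Nat.le_of_dvd (by norm_num) ⟨q, h6.symm⟩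
      interval_cases p <;> omega
    have hr5 : 5 ≤ r := by
      by_contra! h
      obtain rfl : r = 4 := by omega
      norm_num at hr
    have hcard12 : Nat.card G = 12 * r := by rw [hcard]; norm_num
    exact ⟨card_commutator_of_card_eq_twelve_mul hr hr5 hcard12 hbot,
      TensorSquare.nonempty_equiv_zmod_three_mul_prod_quaternionGroup hr hr5 hcard12⟩
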